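/- Let $n\ge 4$ and let $p,q$ be prime numbers. Put $\Lambda_n=GL_n(\mathbb Z)$. For $g\in GL_n(\mathbb Q)$ let $T_g$ be the Hecke operator $$T_g(f)(h)=\sum_{\delta\in\Lambda_n\backslash\Lambda_n g\Lambda_n}f(\delta h)\qquad(h\in GL_n(\mathbb R)),$$ acting on the functions $f:GL_n(\mathbb R)\to\mathbb C$ that are invariant under left translation by $\Lambda_n$ and under multiplication by nonzero real scalars (so in particular on those which are also right $O_n(\mathbb R)$-invariant, such as $GL_n(\mathbb Z)$-invariant Maass forms). The sum is finite. Let $\delta_{p=q}$ be $1$ if $p=q$ and $0$ otherwise. Then $$T_{\mathrm{diag}(1,\underbrace{p,\dots,p}_{n-1})}\circ T_{\mathrm{diag}(\underbrace{1,\dots,1}_{n-1},q)}=T_{\mathrm{diag}(1,\underbrace{p,\dots,p}_{n-2},pq)}+\delta_{p=q}\frac{p^n-1}{p-1}\,\mathrm{Id}$$ and $$\begin{aligned} T_{\mathrm{diag}(1,\underbrace{p,\dots,p}_{n-2},p^2)}\circ T_{\mathrm{diag}(1,\underbrace{q,\dots,q}_{n-2},q^2)}={}&T_{\mathrm{diag}(1,\underbrace{pq,\dots,pq}_{n-2},(pq)^2)}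 +\delta_{p=q}\frac{2p^n-p^2-2p+1}{p-1}\,T_{\mathrm{diag}(1,\underbrace{p,\dots,p}_{n-2},p^2)}\\ &+\delta_{p=q}\,p\,\frac{(p^{n-1}-1)(p^n-1)}{(p-1)^2}\,\mathrm{Id} +\delta_{p=q}(p+1)\,T_{\mathrm{diag}(1,\underbrace{p^2,\dots,p^2}_{n-3},p^3,p^3)}\\ &+\delta_{p=q}(p+1)\,T_{\mathrm{diag}(1,1,\underbrace{p,\dots,p}_{n-3},p^3)} +\delta_{p=q}(p+1)^2\,T_{\mathrm{diag}(1,1,\underbrace{p,\dots,p}_{n-4},p^2,p^2)}. \end{aligned}$$ -/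

import Mathlib

namespace GLHecke

open Matrix

/-- The group `Λ_n = GL_n(ℤ)`, viewed as a subgroup of `GL_n(ℚ)`. -/
def lam (n : ℕ) : Subgroup (GL (Fin n) ℚ) :=
  (GeneralLinearGroup.map (n := Fin n) (Int.castRingHom ℚ)).range

/-- The inclusion `GL_n(ℚ) → GL_n(ℝ)`. -/
noncomputable def toReal (n : ℕ) : GL (Fin n) ℚ →* GL (Fin n) ℝ :=
  GeneralLinearGroup.map (n := Fin n) (Rat.castHom ℝ)

/-- The complex vector space of functions on `GL_n(ℝ)` that are invariant under left translation by
`Λ_n = GL_n(ℤ)` and under multiplication by the centre `ℝˣ`. The Maass forms of level `1`, being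
functions on `GL_n(ℤ) \ GL_n(ℝ) / (O_n(ℝ) ℝˣ)`, belong to it. -/
def autFun (n : ℕ) : Submodule ℂ (GL (Fin n) ℝ → ℂ) where
  carrier := {f | (∀ γ ∈ lam n, ∀ h, f (toReal n γ * h) = f h) ∧
    ∀ (r : ℝˣ) (h), f (GeneralLinearGroup.scalar (Fin n) r * h) = f h}
  add_mem' := by
    rintro f g ⟨hf, hf'⟩ ⟨hg, hg'⟩
    exact ⟨fun γ hγ h => by simp [hf γ hγ h, hg γ hγ h], fun r h => by simp [hf' r h, hg' r h]⟩
  zero_mem' := ⟨fun _ _ _ => rfl, fun _ _ => rfl⟩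
  smul_mem' := by
    rintro c f ⟨hf, hf'⟩
    exact ⟨fun γ hγ h => by simp [hf γ hγ h], fun r h => by simp [hf' r h]⟩

/-- The set `Λ_n \ GL_n(ℚ)` of the cosets `Λ_n δ`. -/
abbrev Coset (n : ℕ) : Type := Quotient (QuotientGroup.rightRel (lam n))

/-- The set `Λ_n \ Λ_n g Λ_n` of the cosets `Λ_n δ` contained in the double coset of `g`. -/
def cosets {n : ℕ} (g : GL (Fin n) ℚ) : Set (Coset n) :=
  Quotient.mk (QuotientGroup.rightRel (lam n)) '' DoubleCoset.doubleCoset g (lam n) (lam n)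

theorem exists_common_denom {n : ℕ} (A : Matrix (Fin n) (Fin n) ℚ) :
    ∃ N : ℕ, N ≠ 0 ∧ ∃ B : Matrix (Fin n) (Fin n) ℤ, (N : ℚ) • A = B.map (Int.castRingHom ℚ) := by
  refine ⟨∏ i, ∏ j, (A i j).den, ?_, ?_⟩
  · exact Finset.prod_ne_zero_iff.2 fun i _ => Finset.prod_ne_zero_iff.2 fun j _ => (A i j).den_nz
  · have key : ∀ i j, ∃ b : ℤ, ((∏ i, ∏ j, (A i j).den : ℕ) : ℚ) * A i j = b := by
      intro i j
      have hd : (A i j).den ∣ ∏ i, ∏ j, (A i j).den :=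
        (Finset.dvd_prod_of_mem (fun j => (A i j).den) (Finset.mem_univ j)).trans
          (Finset.dvd_prod_of_mem (fun i => ∏ j, (A i j).den) (Finset.mem_univ i))
      obtain ⟨k, hk⟩ := hd
      refine ⟨k * (A i j).num, ?_⟩
      rw [hk]
      push_cast
      rw [mul_comm ((A i j).den : ℚ), mul_assoc, Rat.den_mul_eq_num]
    choose B hB using key
    exact ⟨Matrix.of B, by ext i j; simpa using hB i j⟩

/-- If `γ ≡ γ' mod N₁ N₂`, where `N₁ g` and `N₂ g⁻¹` are integral, then `g γ γ'⁻¹ g⁻¹` is integral. -/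
theorem conj_integral {n : ℕ} (g : GL (Fin n) ℚ) {N₁ N₂ : ℕ} {B₁ B₂ : Matrix (Fin n) (Fin n) ℤ}
    (h₁ : (N₁ : ℚ) • (g : Matrix (Fin n) (Fin n) ℚ) = B₁.map (Int.castRingHom ℚ))
    (h₂ : (N₂ : ℚ) • ((g⁻¹ : GL (Fin n) ℚ) : Matrix (Fin n) (Fin n) ℚ) =
      B₂.map (Int.castRingHom ℚ))
    (γ γ' : GL (Fin n) ℤ)
    (h : GeneralLinearGroup.map (n := Fin n) (Int.castRingHom (ZMod (N₁ * N₂))) γ =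
      GeneralLinearGroup.map (n := Fin n) (Int.castRingHom (ZMod (N₁ * N₂))) γ') :
    ∃ C : Matrix (Fin n) (Fin n) ℤ, ((g * GeneralLinearGroup.map (Int.castRingHom ℚ) (γ * γ'⁻¹) *
      g⁻¹ : GL (Fin n) ℚ) : Matrix (Fin n) (Fin n) ℚ) = C.map (Int.castRingHom ℚ) := by
  have hM : ∃ M : Matrix (Fin n) (Fin n) ℤ,
      ((γ * γ'⁻¹ : GL (Fin n) ℤ) : Matrix (Fin n) (Fin n) ℤ) = 1 + ((N₁ * N₂ : ℕ) : ℤ) • M := by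
    have h1 : GeneralLinearGroup.map (n := Fin n) (Int.castRingHom (ZMod (N₁ * N₂)))
        (γ * γ'⁻¹) = 1 := by rw [map_mul, map_inv, h, mul_inv_cancel]
    have key : ∀ i j, ∃ m : ℤ, ((γ * γ'⁻¹ : GL (Fin n) ℤ) : Matrix (Fin n) (Fin n) ℤ) i j =
        (1 : Matrix (Fin n) (Fin n) ℤ) i j + ((N₁ * N₂ : ℕ) : ℤ) * m := by
      intro i j
      have h2 := congrArg (fun x : GL (Fin n) (ZMod (N₁ * N₂)) =>
        (x : Matrix (Fin n) (Fin n) (ZMod (N₁ * N₂))) i j) h1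
      have h3 : ((((γ * γ'⁻¹ : GL (Fin n) ℤ) : Matrix (Fin n) (Fin n) ℤ) i j : ℤ) :
          ZMod (N₁ * N₂)) = (((1 : Matrix (Fin n) (Fin n) ℤ) i j : ℤ) : ZMod (N₁ * N₂)) := by
        refine Eq.trans ?_ (h2.trans ?_)
        · rfl
        · simp [Matrix.one_apply]
      have h4 := (ZMod.intCast_eq_intCast_iff_dvd_sub _ _ _).1 h3.symm
      obtain ⟨m, hm⟩ := h4
      exact ⟨m, by linarith⟩
    choose M hM using key
    exact ⟨Matrix.of M, by ext i j; simpa using hM i j⟩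
  obtain ⟨M, hM⟩ := hM
  refine ⟨1 + B₁ * M * B₂, ?_⟩
  have e : ((GeneralLinearGroup.map (n := Fin n) (Int.castRingHom ℚ) (γ * γ'⁻¹) :
      GL (Fin n) ℚ) : Matrix (Fin n) (Fin n) ℚ) =
      1 + ((N₁ : ℚ) * (N₂ : ℚ)) • M.map (Int.castRingHom ℚ) := by
    have : ((GeneralLinearGroup.map (n := Fin n) (Int.castRingHom ℚ) (γ * γ'⁻¹) :
      GL (Fin n) ℚ) : Matrix (Fin n) (Fin n) ℚ) =
      ((γ * γ'⁻¹ : GL (Fin n) ℤ) : Matrix (Fin n) (Fin n) ℤ).map (Int.castRingHom ℚ) := rfl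
    rw [this, hM]
    ext i j
    simp only [Matrix.map_apply, Matrix.add_apply, Matrix.smul_apply, Matrix.one_apply,
      smul_eq_mul, map_add, map_mul]
    split_ifs <;> simp
  have e' : ((1 + B₁ * M * B₂).map (Int.castRingHom ℚ) : Matrix (Fin n) (Fin n) ℚ) =
      1 + B₁.map (Int.castRingHom ℚ) * M.map (Int.castRingHom ℚ) * B₂.map (Int.castRingHom ℚ) := by
    rw [← RingHom.mapMatrix_apply, map_add, map_one, map_mul, map_mul]
    rfl
  rw [e', ← h₁, ← h₂, Units.val_mul, Units.val_mul, e, mul_add, add_mul, mul_one, Units.mul_inv]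
  congr 1
  simp only [Matrix.mul_smul, Matrix.smul_mul, smul_smul]
  rw [mul_comm (N₂ : ℚ)]

theorem mem_lam_of_integral {n : ℕ} (x : GL (Fin n) ℚ) {C C' : Matrix (Fin n) (Fin n) ℤ}
    (h : (x : Matrix (Fin n) (Fin n) ℚ) = C.map (Int.castRingHom ℚ))
    (h' : ((x⁻¹ : GL (Fin n) ℚ) : Matrix (Fin n) (Fin n) ℚ) = C'.map (Int.castRingHom ℚ)) :
    x ∈ lam n := by
  have inj : Function.Injective (RingHom.mapMatrix (m := Fin n) (Int.castRingHom ℚ)) := by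
    intro A B hAB
    ext i j
    have := congrArg (fun X : Matrix (Fin n) (Fin n) ℚ => X i j) hAB
    simpa using this
  refine ⟨⟨C, C', inj ?_, inj ?_⟩, Units.ext h.symm⟩
  · rw [map_mul, map_one, RingHom.mapMatrix_apply, RingHom.mapMatrix_apply, ← h, ← h',
      Units.mul_inv]
  · rw [map_mul, map_one, RingHom.mapMatrix_apply, RingHom.mapMatrix_apply, ← h, ← h',
      Units.inv_mul]

/-- The double coset `Λ_n g Λ_n` is a finite union of cosets `Λ_n δ`. -/
theorem finite_cosets {n : ℕ} (g : GL (Fin n) ℚ) : (cosets g).Finite := by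
  obtain ⟨N₁, hN₁, B₁, h₁⟩ := exists_common_denom (g : Matrix (Fin n) (Fin n) ℚ)
  obtain ⟨N₂, hN₂, B₂, h₂⟩ := exists_common_denom ((g⁻¹ : GL (Fin n) ℚ) : Matrix (Fin n) (Fin n) ℚ)
  have : NeZero (N₁ * N₂) := ⟨mul_ne_zero hN₁ hN₂⟩
  let F : GL (Fin n) ℤ → Coset n := fun γ =>
    Quotient.mk _ (g * GeneralLinearGroup.map (Int.castRingHom ℚ) γ)
  let φ : GL (Fin n) ℤ → GL (Fin n) (ZMod (N₁ * N₂)) := GeneralLinearGroup.map (Int.castRingHom _)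
  have hF : F.FactorsThrough φ := by
    intro a b hab
    obtain ⟨C, hC⟩ := conj_integral g h₁ h₂ b a hab.symm
    obtain ⟨C', hC'⟩ := conj_integral g h₁ h₂ a b hab
    refine Quotient.sound ?_
    change QuotientGroup.rightRel (lam n) _ _
    rw [QuotientGroup.rightRel_apply]
    refine mem_lam_of_integral _ (C := C) (C' := C') ?_ ?_
    · rw [← hC, map_mul, map_inv]
      exact congrArg Units.val (by group)
    · rw [← hC', map_mul, map_inv]
      exact congrArg Units.val (by group)
  refine (Set.finite_range (Function.extend φ F fun _ => Quotient.mk _ 1)).subset ?_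
  rintro _ ⟨x, hx, rfl⟩
  obtain ⟨a, ha, b, ⟨γ, rfl⟩, rfl⟩ := DoubleCoset.mem_doubleCoset.1 hx
  refine ⟨φ γ, ?_⟩
  rw [hF.extend_apply]
  refine Quotient.sound ?_
  change QuotientGroup.rightRel (lam n) _ _
  rw [QuotientGroup.rightRel_apply]
  simpa [mul_assoc] using ha

/-- The value `f (δ h)`, which only depends on the coset `Λ_n δ`. -/
noncomputable def cosetValue {n : ℕ} (f : autFun n) (h : GL (Fin n) ℝ) : Coset n → ℂ :=
  Quotient.lift (fun δ => (f : GL (Fin n) ℝ → ℂ) (toReal n δ * h)) (by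
    intro a b hab
    have hab' : b * a⁻¹ ∈ lam n := QuotientGroup.rightRel_apply.1 hab
    have := f.2.1 _ hab' (toReal n a * h)
    rw [← mul_assoc, ← map_mul, inv_mul_cancel_right] at this
    exact this.symm)

/-- Right translation `Λ_n δ ↦ Λ_n δ γ` on `Λ_n \ GL_n(ℚ)`. -/
def cosetMul {n : ℕ} (γ : GL (Fin n) ℚ) : Coset n → Coset n :=
  Quotient.map (fun δ => δ * γ) (by
    intro a b hab
    have hab' : b * a⁻¹ ∈ lam n := QuotientGroup.rightRel_apply.1 hab
    refine QuotientGroup.rightRel_apply.2 ?_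
    simpa [mul_assoc] using hab')

theorem cosetMul_mem {n : ℕ} (g γ : GL (Fin n) ℚ) (hγ : γ ∈ lam n) (c : Coset n)
    (hc : c ∈ cosets g) : cosetMul γ c ∈ cosets g := by
  obtain ⟨x, hx, rfl⟩ := hc
  obtain ⟨a, ha, b, hb, rfl⟩ := DoubleCoset.mem_doubleCoset.1 hx
  exact ⟨a * g * b * γ, DoubleCoset.mem_doubleCoset.2
    ⟨a, ha, b * γ, (lam n).mul_mem hb hγ, by simp only [mul_assoc]⟩, rfl⟩

theorem cosetMul_cancel {n : ℕ} (γ : GL (Fin n) ℚ) (c : Coset n) :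
    cosetMul γ⁻¹ (cosetMul γ c) = c := by
  induction c using Quotient.inductionOn with
  | h x => exact congrArg (Quotient.mk _) (mul_inv_cancel_right x γ)

/-- The Hecke operator `T_g`, `(T_g f)(h) = ∑_{δ ∈ Λ_n \ Λ_n g Λ_n} f (δ h)`, for `g` in
`GL_n(ℚ)`. -/
noncomputable def hecke {n : ℕ} (g : GL (Fin n) ℚ) : Module.End ℂ (autFun n) where
  toFun f := ⟨fun h => ∑ c ∈ (finite_cosets g).toFinset, cosetValue f h c, by
    refine ⟨fun γ hγ h => ?_, fun r h => ?_⟩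
    · refine Finset.sum_nbij' (cosetMul γ) (cosetMul γ⁻¹) ?_ ?_ ?_ ?_ ?_
      · intro c hc
        rw [Set.Finite.mem_toFinset] at hc ⊢
        exact cosetMul_mem g γ hγ c hc
      · intro c hc
        rw [Set.Finite.mem_toFinset] at hc ⊢
        exact cosetMul_mem g γ⁻¹ ((lam n).inv_mem hγ) c hc
      · intro c _
        exact cosetMul_cancel γ c
      · intro c _
        simpa using cosetMul_cancel γ⁻¹ c
      · intro c _
        induction c using Quotient.inductionOn with
        | h x =>
          change (f : GL (Fin n) ℝ → ℂ) (toReal n x * (toReal n γ * h)) =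
            (f : GL (Fin n) ℝ → ℂ) (toReal n (x * γ) * h)
          rw [map_mul, mul_assoc]
    · refine Finset.sum_congr rfl fun c _ => ?_
      induction c using Quotient.inductionOn with
      | h x =>
        change (f : GL (Fin n) ℝ → ℂ) (toReal n x * (GeneralLinearGroup.scalar (Fin n) r * h)) =
          (f : GL (Fin n) ℝ → ℂ) (toReal n x * h)
        rw [← mul_assoc, ← GeneralLinearGroup.scalar_commute, mul_assoc, f.2.2 r]⟩
  map_add' f₁ f₂ := by
    ext h
    change ∑ c ∈ _, cosetValue (f₁ + f₂) h c = ∑ c ∈ _, cosetValue f₁ h c + ∑ c ∈ _, cosetValue f₂ h c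
    rw [← Finset.sum_add_distrib]
    refine Finset.sum_congr rfl fun c _ => ?_
    induction c using Quotient.inductionOn with
    | h x => rfl
  map_smul' a f := by
    ext h
    change ∑ c ∈ _, cosetValue (a • f) h c = a • ∑ c ∈ _, cosetValue f h c
    rw [Finset.smul_sum]
    refine Finset.sum_congr rfl fun c _ => ?_
    induction c using Quotient.inductionOn with
    | h x => rfl

/-- The matrix `diag(d_1, …, d_n)` in `GL_n(ℚ)`, for positive integers `d_1, …, d_n`. -/
noncomputable def diagGL {n : ℕ} (d : Fin n → ℕ+) : GL (Fin n) ℚ :=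
  GeneralLinearGroup.mkOfDetNeZero (Matrix.diagonal fun i => ((d i : ℕ) : ℚ)) (by
    rw [Matrix.det_diagonal]
    exact Finset.prod_ne_zero_iff.2 fun i _ => Nat.cast_ne_zero.2 (d i).ne_zero)

/-- The tuple `(a, …, a, b, …, b, c, …, c)` of length `n` with `k` entries `a` at the beginning,
`l` entries `c` at the end and `n - k - l` entries `b` between them (for `k + l ≤ n`). -/
def blocks (n k l : ℕ) (a b c : ℕ+) : Fin n → ℕ+ :=
  fun i => if (i : ℕ) < k then a else if (i : ℕ) + l < n then b else c

/-- The Hecke operator of `diag(a, …, a, b, …, b, c, …, c)`, with `k` entries `a`,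
`n - k - l` entries `b` and `l` entries `c`. -/
noncomputable def T (n k l : ℕ) (a b c : ℕ+) : Module.End ℂ (autFun n) :=
  hecke (diagGL (blocks n k l a b c))

end GLHecke

/-! Since `lam n` is the stabiliser of ℤ^n, a coset Λ_n δ is the same thing as the lattice ℤ^n δ.
Thus T_g sums f over the lattices in a prescribed position relative to L = ℤ^n, and the kernel of
T_g ∘ T_g' at a lattice K is the number of intermediate lattices H with H in position g relative to
L and K in position g' relative to H (`hasKernel_hecke_comp_hecke`). Each identity becomes an
equality of two functions of K (`HasKernel.eq`).

By the elementary divisor theorem (`exists_divisorChain`) the positions that occur are recognised by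
the indices [L : L ∩ K] and [K : L ∩ K], together with whether p kills L/(L ∩ K) and K/(L ∩ K)
(`indexRel_iff_mem_orbitLat`). The rest is counting of subgroups in an abelian group.

For the first identity, L ≤ H with index p and K ≤ H with index q. Since L has prime index in H,
either H = L + K is determined by K, or p = q and K = L; in the latter case H is any of the m = (p^n
- 1)/(p - 1) overgroups of L of index p.

For the second identity call two lattices adjacent when their intersection has index p in both. If p
≠ q, the intermediate H is determined by v ∈ H ↔ pv ∈ L and qv ∈ K, so every count is 0 or 1. If p =
q, there are three kinds of K (`relIndex_of_adj_of_adj`). For K = L the count is the number m(m - 1)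
of neighbours of L. For K adjacent to L, the common neighbours lie above L ∩ K or below L + K, and
inclusion-exclusion gives 2m - (p + 3) (`ncard_common_adj_of_adj`). If both indices are p², then H
corresponds to a pair of subgroups, one between L ∩ K and L and one between L ∩ K and K. A quotient
of order p² has p + 1 subgroups of index p if it is killed by p and one if it is cyclic, whence the
coefficients 1, p + 1, p + 1 and (p + 1)² (`ncard_common_adj_of_relIndex_sq`). -/

namespace GLHecke

open Matrix

/-! ### Lattices in ℚ^n and the right action of GL_n(ℚ) -/

/-- Right multiplication by `x ∈ GL_n(ℚ)` on row vectors. -/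
def rmul {n : ℕ} (x : GL (Fin n) ℚ) : (Fin n → ℚ) ≃+ (Fin n → ℚ) where
  toFun v := v ᵥ* (x : Matrix (Fin n) (Fin n) ℚ)
  invFun v := v ᵥ* ((x⁻¹ : GL (Fin n) ℚ) : Matrix (Fin n) (Fin n) ℚ)
  left_inv v := by beta_reduce; rw [vecMul_vecMul, Units.mul_inv, vecMul_one]
  right_inv v := by beta_reduce; rw [vecMul_vecMul, Units.inv_mul, vecMul_one]
  map_add' v w := add_vecMul _ v w

theorem rmul_apply {n : ℕ} (x : GL (Fin n) ℚ) (v : Fin n → ℚ) :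
    rmul x v = v ᵥ* (x : Matrix (Fin n) (Fin n) ℚ) := rfl

/-- The right action of `GL_n(ℚ)` on the subgroups of `ℚ^n`. -/
def act {n : ℕ} (x : GL (Fin n) ℚ) (H : AddSubgroup (Fin n → ℚ)) : AddSubgroup (Fin n → ℚ) :=
  H.map (rmul x).toAddMonoidHom

theorem mem_act {n : ℕ} {x : GL (Fin n) ℚ} {H : AddSubgroup (Fin n → ℚ)} {v : Fin n → ℚ} :
    v ∈ act x H ↔ ∃ w ∈ H, rmul x w = v := AddSubgroup.mem_map

theorem rmul_mem_act {n : ℕ} {x : GL (Fin n) ℚ} {H : AddSubgroup (Fin n → ℚ)} {v : Fin n → ℚ} :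
    rmul x v ∈ act x H ↔ v ∈ H :=
  AddSubgroup.mem_map_iff_mem (rmul x).injective

theorem rmul_mul {n : ℕ} (x y : GL (Fin n) ℚ) (v : Fin n → ℚ) :
    rmul (x * y) v = rmul y (rmul x v) := by
  simp [rmul_apply, vecMul_vecMul]

theorem act_mul {n : ℕ} (x y : GL (Fin n) ℚ) (H : AddSubgroup (Fin n → ℚ)) :
    act (x * y) H = act y (act x H) := by
  ext v
  simp only [mem_act, rmul_mul]
  constructor
  · rintro ⟨w, hw, rfl⟩
    exact ⟨_, ⟨w, hw, rfl⟩, rfl⟩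
  · rintro ⟨_, ⟨w, hw, rfl⟩, rfl⟩
    exact ⟨w, hw, rfl⟩

@[simp]
theorem act_one {n : ℕ} (H : AddSubgroup (Fin n → ℚ)) : act 1 H = H := by
  ext v
  simp [mem_act, rmul_apply]

@[simp]
theorem act_inv_act {n : ℕ} (x : GL (Fin n) ℚ) (H : AddSubgroup (Fin n → ℚ)) :
    act x⁻¹ (act x H) = H := by
  rw [← act_mul, mul_inv_cancel, act_one]

@[simp]
theorem act_act_inv {n : ℕ} (x : GL (Fin n) ℚ) (H : AddSubgroup (Fin n → ℚ)) :
    act x (act x⁻¹ H) = H := by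
  rw [← act_mul, inv_mul_cancel, act_one]

theorem act_injective {n : ℕ} (x : GL (Fin n) ℚ) : Function.Injective (act x) :=
  Function.LeftInverse.injective (g := act x⁻¹) (act_inv_act x)

theorem act_le_act {n : ℕ} {x : GL (Fin n) ℚ} {H K : AddSubgroup (Fin n → ℚ)} :
    act x H ≤ act x K ↔ H ≤ K :=
  AddSubgroup.map_le_map_iff_of_injective (rmul x).injective

theorem relIndex_act {n : ℕ} (x : GL (Fin n) ℚ) (H K : AddSubgroup (Fin n → ℚ)) :
    (act x H).relIndex (act x K) = H.relIndex K :=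
  AddSubgroup.relIndex_map_map_of_injective _ _ (rmul x).injective

/-- The relation `m H ≤ K`. -/
def NsmulLE {V : Type*} [AddCommGroup V] (m : ℕ) (H K : AddSubgroup V) : Prop :=
  ∀ v ∈ H, m • v ∈ K

theorem nsmulLE_act {n : ℕ} (x : GL (Fin n) ℚ) (m : ℕ) (H K : AddSubgroup (Fin n → ℚ)) :
    NsmulLE m (act x H) (act x K) ↔ NsmulLE m H K := by
  constructor
  · intro h v hv
    have := h _ (rmul_mem_act.2 hv)
    rwa [← map_nsmul, rmul_mem_act] at this
  · rintro h _ ⟨v, hv, rfl⟩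
    exact ⟨m • v, h v hv, map_nsmul (rmul x) m v⟩

/-- The lattice `⨁ ℤ a_i e_i`. -/
def box {n : ℕ} (a : Fin n → ℚ) : AddSubgroup (Fin n → ℚ) :=
  AddSubgroup.pi Set.univ fun i => AddSubgroup.zmultiples (a i)

theorem mem_box {n : ℕ} {a v : Fin n → ℚ} : v ∈ box a ↔ ∀ i, ∃ z : ℤ, (z : ℚ) * a i = v i := by
  simp [box, AddSubgroup.mem_pi, AddSubgroup.mem_zmultiples_iff]

/-- The standard lattice `ℤ^n`. -/
def stdLat (n : ℕ) : AddSubgroup (Fin n → ℚ) := box fun _ => 1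

theorem mem_stdLat {n : ℕ} {v : Fin n → ℚ} : v ∈ stdLat n ↔ ∀ i, ∃ z : ℤ, (z : ℚ) = v i := by
  simp [stdLat, mem_box]

theorem single_mem_stdLat {n : ℕ} (i : Fin n) : Pi.single i (1 : ℚ) ∈ stdLat n := by
  refine mem_stdLat.2 fun j => ⟨if j = i then 1 else 0, ?_⟩
  by_cases h : j = i
  · subst h; simp
  · simp [h]

theorem exists_integral_of_act_le {n : ℕ} {x : GL (Fin n) ℚ} (h : act x (stdLat n) ≤ stdLat n) :
    ∃ C : Matrix (Fin n) (Fin n) ℤ,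
      (x : Matrix (Fin n) (Fin n) ℚ) = C.map (Int.castRingHom ℚ) := by
  have key : ∀ i j, ∃ z : ℤ, (z : ℚ) = (x : Matrix (Fin n) (Fin n) ℚ) i j := by
    intro i j
    have h1 := h (rmul_mem_act.2 (single_mem_stdLat i))
    rw [rmul_apply, single_one_vecMul] at h1
    exact mem_stdLat.1 h1 j
  choose C hC using key
  exact ⟨Matrix.of C, by ext i j; simp [hC]⟩

theorem mem_lam_of_act_eq {n : ℕ} {x : GL (Fin n) ℚ} (h : act x (stdLat n) = stdLat n) :
    x ∈ lam n := by
  obtain ⟨C, hC⟩ := exists_integral_of_act_le h.le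
  have h' : act x⁻¹ (stdLat n) = stdLat n := by
    conv_lhs => rw [← h]
    exact act_inv_act _ _
  obtain ⟨C', hC'⟩ := exists_integral_of_act_le h'.le
  exact mem_lam_of_integral x hC hC'

theorem act_le_of_mem_lam {n : ℕ} {x : GL (Fin n) ℚ} (h : x ∈ lam n) :
    act x (stdLat n) ≤ stdLat n := by
  obtain ⟨γ, rfl⟩ := h
  rintro _ ⟨v, hv, rfl⟩
  have hv' := mem_stdLat.1 hv
  choose z hz using hv'
  refine mem_stdLat.2 fun j => ⟨∑ i, z i * (γ : Matrix (Fin n) (Fin n) ℤ) i j, ?_⟩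
  change _ = (v ᵥ* ((γ : Matrix (Fin n) (Fin n) ℤ).map (Int.castRingHom ℚ))) j
  simp [vecMul, dotProduct, hz]

theorem act_of_mem_lam {n : ℕ} {x : GL (Fin n) ℚ} (h : x ∈ lam n) :
    act x (stdLat n) = stdLat n := by
  refine le_antisymm (act_le_of_mem_lam h) ?_
  have := act_le_act (x := x).2 (act_le_of_mem_lam ((lam n).inv_mem h))
  rwa [act_act_inv] at this

/-- The stabiliser of ℤ^n is Λ_n: a matrix that fixes ℤ^n is integral, and so is its inverse. This
is what turns cosets into lattices. -/
theorem act_stdLat_eq_iff {n : ℕ} (x y : GL (Fin n) ℚ) :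
    act x (stdLat n) = act y (stdLat n) ↔ y * x⁻¹ ∈ lam n := by
  constructor
  · intro h
    apply mem_lam_of_act_eq
    rw [act_mul, ← h, act_inv_act]
  · intro h
    have := act_of_mem_lam h
    rw [act_mul] at this
    conv_lhs => rw [← this]
    exact act_act_inv _ _

/-! ### Hecke operators as sums over lattices, and their kernels -/

/-- The lattice `ℤ^n δ` of a coset `Λ_n δ`. -/
def latOf {n : ℕ} : Coset n → AddSubgroup (Fin n → ℚ) :=
  Quotient.lift (fun δ => act δ (stdLat n)) fun a b hab =>
    (act_stdLat_eq_iff a b).2 (QuotientGroup.rightRel_apply.1 hab)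

theorem latOf_injective {n : ℕ} : Function.Injective (latOf (n := n)) := by
  intro c d
  induction c, d using Quotient.inductionOn₂ with
  | h x y =>
    intro h
    exact Quotient.sound (QuotientGroup.rightRel_apply.2 ((act_stdLat_eq_iff x y).1 h))

open Classical in
/-- The value `f (x h)` for a lattice `ℤ^n x`. -/
noncomputable def latValue {n : ℕ} (f : autFun n) (h : GL (Fin n) ℝ)
    (K : AddSubgroup (Fin n → ℚ)) : ℂ :=
  if hK : ∃ x, act x (stdLat n) = K then
    (f : GL (Fin n) ℝ → ℂ) (toReal n hK.choose * h) else 0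

theorem latValue_act {n : ℕ} (f : autFun n) (h : GL (Fin n) ℝ) (x : GL (Fin n) ℚ) :
    latValue f h (act x (stdLat n)) = (f : GL (Fin n) ℝ → ℂ) (toReal n x * h) := by
  have hK : ∃ y, act y (stdLat n) = act x (stdLat n) := ⟨x, rfl⟩
  rw [latValue, dif_pos hK]
  have h1 := (act_stdLat_eq_iff _ _).1 hK.choose_spec
  have h2 := f.2.1 _ h1 (toReal n hK.choose * h)
  rw [← mul_assoc, ← map_mul, inv_mul_cancel_right] at h2
  exact h2.symm

theorem latValue_latOf {n : ℕ} (f : autFun n) (h : GL (Fin n) ℝ) (c : Coset n) :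
    latValue f h (latOf c) = cosetValue f h c := by
  induction c using Quotient.inductionOn with
  | h x => exact latValue_act f h x

/-- Moves a rational matrix from the argument into the lattice; this expands the inner operator of a
composition. -/
theorem latValue_toReal_mul {n : ℕ} (f : autFun n) (h : GL (Fin n) ℝ) (x : GL (Fin n) ℚ)
    (K : AddSubgroup (Fin n → ℚ)) :
    latValue f (toReal n x * h) K = latValue f h (act x K) := by
  by_cases hK : ∃ y, act y (stdLat n) = K
  · obtain ⟨y, rfl⟩ := hK
    rw [← act_mul, latValue_act, latValue_act, map_mul, mul_assoc]
  · rw [latValue, dif_neg hK, latValue, dif_neg]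
    rintro ⟨y, hy⟩
    exact hK ⟨y * x⁻¹, by rw [act_mul, hy, act_inv_act]⟩

/-- The lattices of the cosets in `Λ_n \ Λ_n g Λ_n`. -/
def orbitLat {n : ℕ} (g : GL (Fin n) ℚ) : Set (AddSubgroup (Fin n → ℚ)) :=
  {K | ∃ γ ∈ lam n, K = act (g * γ) (stdLat n)}

theorem image_latOf_cosets {n : ℕ} (g : GL (Fin n) ℚ) : latOf '' cosets g = orbitLat g := by
  ext K
  constructor
  · rintro ⟨_, ⟨x, hx, rfl⟩, rfl⟩
    obtain ⟨a, ha, b, hb, rfl⟩ := DoubleCoset.mem_doubleCoset.1 hx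
    refine ⟨b, hb, ?_⟩
    change act (a * g * b) (stdLat n) = _
    rw [mul_assoc, act_mul, act_of_mem_lam ha]
  · rintro ⟨γ, hγ, rfl⟩
    exact ⟨_, ⟨g * γ, DoubleCoset.mem_doubleCoset.2 ⟨1, (lam n).one_mem, γ, hγ, by simp⟩, rfl⟩, rfl⟩

theorem finite_orbitLat {n : ℕ} (g : GL (Fin n) ℚ) : (orbitLat g).Finite := by
  rw [← image_latOf_cosets]
  exact (finite_cosets g).image _

theorem hecke_apply {n : ℕ} (g : GL (Fin n) ℚ) (f : autFun n) (h : GL (Fin n) ℝ) :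
    (hecke g f : GL (Fin n) ℝ → ℂ) h = ∑ K ∈ (finite_orbitLat g).toFinset, latValue f h K := by
  classical
  change ∑ c ∈ (finite_cosets g).toFinset, cosetValue f h c = _
  have : (finite_orbitLat g).toFinset = (finite_cosets g).toFinset.image latOf := by
    ext K
    simp [← image_latOf_cosets]
  rw [this, Finset.sum_image latOf_injective.injOn]
  exact Finset.sum_congr rfl fun c _ => (latValue_latOf f h c).symm

/-- `O` is the operator `f ↦ (h ↦ ∑_K κ(K) f(K h))`, the sum over all lattices `K`. -/
def HasKernel {n : ℕ} (O : Module.End ℂ (autFun n)) (κ : AddSubgroup (Fin n → ℚ) → ℂ) : Prop :=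
  κ.support.Finite ∧ ∀ f h, (O f : GL (Fin n) ℝ → ℂ) h = ∑ᶠ K, κ K * latValue f h K

theorem HasKernel.eq {n : ℕ} {O O' : Module.End ℂ (autFun n)}
    {κ : AddSubgroup (Fin n → ℚ) → ℂ} (h : HasKernel O κ) (h' : HasKernel O' κ) : O = O' := by
  ext f x
  rw [h.2, h'.2]

theorem HasKernel.add {n : ℕ} {O O' : Module.End ℂ (autFun n)}
    {κ κ' : AddSubgroup (Fin n → ℚ) → ℂ} (h : HasKernel O κ) (h' : HasKernel O' κ') :
    HasKernel (O + O') fun K => κ K + κ' K := by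
  refine ⟨(h.1.union h'.1).subset (Function.support_add _ _), fun f x => ?_⟩
  change (O f : GL (Fin n) ℝ → ℂ) x + (O' f : GL (Fin n) ℝ → ℂ) x = _
  rw [h.2, h'.2, ← finsum_add_distrib]
  · simp only [add_mul]
  · exact h.1.subset fun K hK => left_ne_zero_of_mul hK
  · exact h'.1.subset fun K hK => left_ne_zero_of_mul hK

theorem HasKernel.smul {n : ℕ} {O : Module.End ℂ (autFun n)}
    {κ : AddSubgroup (Fin n → ℚ) → ℂ} (c : ℂ) (h : HasKernel O κ) :
    HasKernel (c • O) fun K => c * κ K := by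
  refine ⟨h.1.subset fun K hK => right_ne_zero_of_mul hK, fun f x => ?_⟩
  change c • (O f : GL (Fin n) ℝ → ℂ) x = _
  rw [h.2, smul_finsum' _ (h.1.subset fun K hK => left_ne_zero_of_mul hK)]
  simp only [smul_eq_mul, mul_assoc]

open Classical in
theorem hasKernel_id {n : ℕ} :
    HasKernel (LinearMap.id : Module.End ℂ (autFun n)) fun K => if K = stdLat n then 1 else 0 := by
  refine ⟨(Set.finite_singleton (stdLat n)).subset fun K hK => ?_, fun f h => ?_⟩
  · by_contra h
    exact hK (if_neg h)
  · rw [finsum_eq_single _ (stdLat n)]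
    · have := latValue_act f h 1
      simpa using this.symm
    · intro K hK
      simp [hK]

/-- The lattices of rg are those of g scaled by r, and f does not see real scalars. Representatives
can therefore be normalised to have middle block 1. -/
theorem hecke_smul {n : ℕ} (r : ℚˣ) (g : GL (Fin n) ℚ) :
    hecke (GeneralLinearGroup.scalar (Fin n) r * g) = hecke g := by
  classical
  set s : GL (Fin n) ℚ := GeneralLinearGroup.scalar (Fin n) r
  have hs : ∀ y : GL (Fin n) ℚ, s * y = y * s := fun y =>
    GeneralLinearGroup.scalar_commute _ _
  ext f h
  rw [hecke_apply, hecke_apply]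
  have : (finite_orbitLat (s * g)).toFinset = (finite_orbitLat g).toFinset.image (act s) := by
    ext K
    simp only [Set.Finite.mem_toFinset, Finset.mem_image]
    constructor
    · rintro ⟨γ, hγ, rfl⟩
      exact ⟨_, ⟨γ, hγ, rfl⟩, by rw [← act_mul, ← hs, mul_assoc]⟩
    · rintro ⟨_, ⟨γ, hγ, rfl⟩, rfl⟩
      exact ⟨γ, hγ, by rw [← act_mul, ← hs, mul_assoc]⟩
  rw [this, Finset.sum_image (act_injective s).injOn]
  refine Finset.sum_congr rfl fun K hK => ?_
  obtain ⟨γ, -, rfl⟩ := (finite_orbitLat g).mem_toFinset.1 hK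
  rw [← act_mul, latValue_act, latValue_act, ← hs, map_mul, mul_assoc]
  have : toReal n s = GeneralLinearGroup.scalar (Fin n) (Units.map (Rat.castHom ℝ) r) := by
    ext i j
    simp [s, toReal, Matrix.scalar_apply, Matrix.diagonal_apply]
    split_ifs <;> simp
  rw [this, f.2.2]

/-- A relation between subgroups of `ℚ^n` that is invariant under `GL_n(ℚ)`. -/
def IsInvariant {n : ℕ} (R : AddSubgroup (Fin n → ℚ) → AddSubgroup (Fin n → ℚ) → Prop) : Prop :=
  ∀ x H K, R (act x H) (act x K) ↔ R H K

open Classical in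
theorem hasKernel_hecke {n : ℕ} {g : GL (Fin n) ℚ}
    {R : AddSubgroup (Fin n → ℚ) → AddSubgroup (Fin n → ℚ) → Prop}
    (hg : ∀ K, R (stdLat n) K ↔ K ∈ orbitLat g) :
    HasKernel (hecke g) fun K => if R (stdLat n) K then 1 else 0 := by
  refine ⟨(finite_orbitLat g).subset fun K hK => ?_, fun f h => ?_⟩
  · by_contra h
    exact hK (if_neg fun h' => h ((hg K).1 h'))
  · rw [hecke_apply, finsum_eq_sum_of_support_subset (s := (finite_orbitLat g).toFinset)]
    · refine Finset.sum_congr rfl fun K hK => ?_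
      beta_reduce
      rw [if_pos ((hg K).2 ((finite_orbitLat g).mem_toFinset.1 hK)), one_mul]
    · intro K hK
      have := left_ne_zero_of_mul hK
      rw [Set.Finite.coe_toFinset, ← hg]
      by_contra h
      exact this (if_neg h)

/-- A double sum over H and then K, with the order of summation exchanged. Invariance of R' allows
the sum defining the inner operator, which is centred at ℤ^n, to be moved to one centred at H. -/
theorem hasKernel_hecke_comp_hecke {n : ℕ} {g g' : GL (Fin n) ℚ}
    {R R' : AddSubgroup (Fin n → ℚ) → AddSubgroup (Fin n → ℚ) → Prop}
    (hR' : IsInvariant R')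
    (hg : ∀ K, R (stdLat n) K ↔ K ∈ orbitLat g) (hg' : ∀ K, R' (stdLat n) K ↔ K ∈ orbitLat g') :
    HasKernel (hecke g ∘ₗ hecke g') fun K => ({H | R (stdLat n) H ∧ R' H K}.ncard : ℂ) := by
  classical
  set S := (finite_orbitLat g).toFinset with hS
  have hS' : ∀ K, K ∈ S ↔ R (stdLat n) K := fun K => by
    rw [hS, Set.Finite.mem_toFinset, hg]
  have hfin : ∀ H ∈ S, {K | R' H K}.Finite := by
    intro H hH
    obtain ⟨γ, -, rfl⟩ := (finite_orbitLat g).mem_toFinset.1 hH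
    refine ((finite_orbitLat g').image (act (g * γ))).subset fun K hK => ?_
    refine ⟨act (g * γ)⁻¹ K, ?_, act_act_inv _ _⟩
    rw [← hg', ← hR' (g * γ), act_act_inv]
    exact hK
  choose! F hF using fun H hH => (hfin H hH).exists_finset
  have hF' : ∀ H ∈ S, ∀ K, K ∈ F H ↔ R' H K := fun H hH K => hF H hH K
  have hcard : ∀ K, {H | R (stdLat n) H ∧ R' H K}.ncard = (S.filter fun H => K ∈ F H).card := by
    intro K
    rw [← Set.ncard_coe_finset]
    congr 1
    ext H
    simp only [Set.mem_ofPred_eq, Finset.coe_filter, ← hS']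
    exact and_congr_right fun hH => (hF' H hH K).symm
  have hsub : ∀ K, (({H | R (stdLat n) H ∧ R' H K}.ncard : ℂ)) ≠ 0 → K ∈ S.biUnion F := by
    intro K hK
    rw [hcard, Nat.cast_ne_zero] at hK
    obtain ⟨H, hH⟩ := Finset.card_pos.1 (Nat.pos_of_ne_zero hK)
    rw [Finset.mem_filter] at hH
    exact Finset.mem_biUnion.2 ⟨H, hH⟩
  refine ⟨(S.biUnion F).finite_toSet.subset hsub, fun f h => ?_⟩
  rw [finsum_eq_sum_of_support_subset (s := S.biUnion F) _
    fun K hK => hsub K (left_ne_zero_of_mul hK)]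
  have h1 : ∀ H ∈ S, latValue (hecke g' f) h H = ∑ K ∈ F H, latValue f h K := by
    intro H hH
    have hH' := hH
    obtain ⟨γ, -, rfl⟩ := (finite_orbitLat g).mem_toFinset.1 hH
    rw [latValue_act, hecke_apply]
    -- Here H = ℤ^n gγ, so gγ carries the lattices in position g' relative to ℤ^n to those in
    -- position R' relative to H.
    refine Finset.sum_bij' (fun K _ => act (g * γ) K) (fun K _ => act (g * γ)⁻¹ K) ?_ ?_ ?_ ?_ ?_
    · intro K hK
      rw [hF' _ hH', hR', hg']
      exact (finite_orbitLat g').mem_toFinset.1 hK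
    · intro K hK
      rw [hF' _ hH'] at hK
      rw [Set.Finite.mem_toFinset, ← hg', ← hR' (g * γ), act_act_inv]
      exact hK
    · intro K _; exact act_inv_act _ _
    · intro K _; exact act_act_inv _ _
    · intro K _; exact latValue_toReal_mul f h _ K
  calc ((hecke g ∘ₗ hecke g') f : GL (Fin n) ℝ → ℂ) h
      = ∑ H ∈ S, latValue (hecke g' f) h H := hecke_apply g (hecke g' f) h
    _ = ∑ H ∈ S, ∑ K ∈ S.biUnion F, if K ∈ F H then latValue f h K else 0 := by
        refine Finset.sum_congr rfl fun H hH => ?_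
        rw [h1 H hH, ← Finset.sum_filter]
        congr 1
        ext K
        simp only [Finset.mem_filter, Finset.mem_biUnion]
        exact ⟨fun h => ⟨⟨H, hH, h⟩, h⟩, fun h => h.2⟩
    _ = ∑ K ∈ S.biUnion F, (({H | R (stdLat n) H ∧ R' H K}.ncard : ℂ)) * latValue f h K := by
        rw [Finset.sum_comm]
        refine Finset.sum_congr rfl fun K _ => ?_
        rw [hcard, ← Finset.sum_filter, Finset.sum_const, nsmul_eq_mul]

/-! ### Elementary divisors of a lattice -/

/-- The matrix in `GL_n(ℚ)` of a linear automorphism of the space of row vectors. -/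
noncomputable def ofLinearEquiv {n : ℕ} (e : (Fin n → ℚ) ≃ₗ[ℚ] (Fin n → ℚ)) : GL (Fin n) ℚ where
  val := (LinearMap.toMatrix' e.toLinearMap)ᵀ
  inv := (LinearMap.toMatrix' e.symm.toLinearMap)ᵀ
  val_inv := by
    rw [← transpose_mul, ← LinearMap.toMatrix'_comp]
    simp
  inv_val := by
    rw [← transpose_mul, ← LinearMap.toMatrix'_comp]
    simp

theorem rmul_ofLinearEquiv {n : ℕ} (e : (Fin n → ℚ) ≃ₗ[ℚ] (Fin n → ℚ)) (v : Fin n → ℚ) :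
    rmul (ofLinearEquiv e) v = e v := by
  change v ᵥ* (LinearMap.toMatrix' e.toLinearMap)ᵀ = e v
  rw [vecMul_transpose, LinearMap.toMatrix'_mulVec]
  rfl

theorem act_ofLinearEquiv_eq {n : ℕ} (e : (Fin n → ℚ) ≃ₗ[ℚ] (Fin n → ℚ))
    {H K : AddSubgroup (Fin n → ℚ)} (h : ∀ v ∈ H, e v ∈ K) (h' : ∀ v ∈ K, e.symm v ∈ H) :
    act (ofLinearEquiv e) H = K := by
  ext v
  rw [mem_act]
  constructor
  · rintro ⟨w, hw, rfl⟩
    rw [rmul_ofLinearEquiv]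
    exact h w hw
  · intro hv
    exact ⟨e.symm v, h' v hv, by rw [rmul_ofLinearEquiv, e.apply_symm_apply]⟩

theorem exists_perm {n : ℕ} (σ : Equiv.Perm (Fin n)) :
    ∃ γ ∈ lam n, ∀ a : Fin n → ℚ, act γ (box a) = box (a ∘ σ) := by
  have key : ∀ a : Fin n → ℚ,
      act (ofLinearEquiv (LinearEquiv.funCongrLeft ℚ ℚ σ)) (box a) = box (a ∘ σ) := by
    intro a
    refine act_ofLinearEquiv_eq _ (fun v hv => ?_) (fun v hv => ?_)
    · rw [mem_box] at hv ⊢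
      exact fun i => hv (σ i)
    · rw [mem_box] at hv ⊢
      intro i
      have := hv (σ.symm i)
      simpa using this
  exact ⟨_, mem_lam_of_act_eq (key fun _ => 1), key⟩

/-- The linear automorphism of `ℚ^n` given by a matrix of determinant `1` in the coordinates `i`
and `j`. -/
def planeEquiv {n : ℕ} {i j : Fin n} (hij : i ≠ j) (α β γ δ : ℤ) (h : α * δ - β * γ = 1) :
    (Fin n → ℚ) ≃ₗ[ℚ] (Fin n → ℚ) where
  toFun v k := if k = i then α * v i + β * v j else if k = j then γ * v i + δ * v j else v k
  invFun v k := if k = i then δ * v i - β * v j else if k = j then α * v j - γ * v i else v k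
  map_add' v w := by
    ext k
    simp only [Pi.add_apply]
    split_ifs <;> ring
  map_smul' c v := by
    ext k
    simp only [Pi.smul_apply, smul_eq_mul, RingHom.id_apply]
    split_ifs <;> ring
  left_inv v := by
    have h' : (α : ℚ) * δ - β * γ = 1 := by exact_mod_cast h
    ext k
    simp only [if_true, if_neg hij.symm]
    split_ifs with h1 h2
    · subst h1; linear_combination (v k) * h'
    · subst h2; linear_combination (v k) * h'
    · rfl
  right_inv v := by
    have h' : (α : ℚ) * δ - β * γ = 1 := by exact_mod_cast h
    ext k
    simp only [if_true, if_neg hij.symm]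
    split_ifs with h1 h2
    · subst h1; linear_combination (v k) * h'
    · subst h2; linear_combination (v k) * h'
    · rfl

theorem exists_gcd_lcm {n : ℕ} {i j : Fin n} (hij : i ≠ j) (d : Fin n → ℕ) (hi : 0 < d i) :
    ∃ γ ∈ lam n, act γ (box fun k => (d k : ℚ)) = box fun k => ((if k = i then Nat.gcd (d i) (d j)
      else if k = j then Nat.lcm (d i) (d j) else d k : ℕ) : ℚ) := by
  set g := Nat.gcd (d i) (d j) with hg
  set l := Nat.lcm (d i) (d j) with hl
  have hg0 : 0 < g := Nat.gcd_pos_of_pos_left _ hi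
  obtain ⟨a, ha⟩ := Nat.gcd_dvd_left (d i) (d j)
  obtain ⟨b, hb⟩ := Nat.gcd_dvd_right (d i) (d j)
  rw [← hg] at ha hb
  have hl' : l = g * a * b := by
    have := Nat.gcd_mul_lcm (d i) (d j)
    rw [← hg, ← hl] at this
    apply Nat.eq_of_mul_eq_mul_left hg0
    rw [this, ha, hb]; ring
  obtain ⟨s, t, hst⟩ : ∃ s t : ℤ, a * s + b * t = 1 := by
    refine ⟨Nat.gcdA (d i) (d j), Nat.gcdB (d i) (d j), ?_⟩
    have := Nat.gcd_eq_gcd_ab (d i) (d j)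
    rw [← hg] at this
    have hg0' : (g : ℤ) ≠ 0 := by exact_mod_cast hg0.ne'
    apply mul_left_cancel₀ hg0'
    have e1 : (d i : ℤ) = g * a := by exact_mod_cast ha
    have e2 : (d j : ℤ) = g * b := by exact_mod_cast hb
    rw [e1, e2] at this
    linear_combination -this
  have ha' : (d i : ℚ) = g * a := by exact_mod_cast ha
  have hb' : (d j : ℚ) = g * b := by exact_mod_cast hb
  have hl'' : (l : ℚ) = g * a * b := by exact_mod_cast hl'
  have hst' : (a : ℚ) * s + b * t = 1 := by exact_mod_cast hst
  have hdet : (1 : ℤ) * (s * a) - 1 * (-(t * b)) = 1 := by linear_combination hst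
  -- With as + bt = 1, the map (x, y) ↦ (x + y, -tb x + sa y) sends (ga z, gb w) to (g(az + bw),
  -- gab(-tz + sw)), and (z, w) ↦ (az + bw, -tz + sw) is unimodular.
  refine ⟨ofLinearEquiv (planeEquiv hij 1 1 (-(t * b)) (s * a) hdet), ?_, ?_⟩
  · refine mem_lam_of_act_eq (act_ofLinearEquiv_eq _ (fun v hv => ?_) (fun v hv => ?_)) <;>
    · rw [mem_stdLat] at hv ⊢
      choose z hz using hv
      intro k
      first
        | change ∃ x : ℤ, _ = (if k = i then ((1 : ℤ) : ℚ) * v i + ((1 : ℤ) : ℚ) * v j else if k = j then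
            ((-(t * b) : ℤ) : ℚ) * v i + ((s * a : ℤ) : ℚ) * v j else v k)
          refine ⟨if k = i then z i + z j else if k = j then -(t * b) * z i + s * a * z j else z k, ?_⟩
          rw [← hz i, ← hz j, ← hz k]
          split_ifs <;> push_cast <;> ring
        | change ∃ x : ℤ, _ = (if k = i then ((s * a : ℤ) : ℚ) * v i - ((1 : ℤ) : ℚ) * v j else if k = j then
            ((1 : ℤ) : ℚ) * v j - ((-(t * b) : ℤ) : ℚ) * v i else v k)
          refine ⟨if k = i then s * a * z i - z j else if k = j then z j + t * b * z i else z k, ?_⟩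
          rw [← hz i, ← hz j, ← hz k]
          split_ifs <;> push_cast <;> ring
  · refine act_ofLinearEquiv_eq _ (fun v hv => ?_) (fun v hv => ?_)
    · rw [mem_box] at hv ⊢
      choose z hz using hv
      intro k
      change ∃ x : ℤ, _ = (if k = i then ((1 : ℤ) : ℚ) * v i + ((1 : ℤ) : ℚ) * v j else if k = j then
            ((-(t * b) : ℤ) : ℚ) * v i + ((s * a : ℤ) : ℚ) * v j else v k)
      refine ⟨if k = i then a * z i + b * z j else if k = j then -t * z i + s * z j else z k, ?_⟩
      rw [← hz i, ← hz j, ← hz k, ha', hb']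
      split_ifs <;> push_cast <;> (try rw [hl'']) <;> ring
    · rw [mem_box] at hv ⊢
      choose z hz using hv
      have hzi := hz i
      have hzj := hz j
      rw [if_pos rfl] at hzi
      rw [if_neg hij.symm, if_pos rfl, hl''] at hzj
      intro k
      have hzk := hz k
      change ∃ x : ℤ, _ = (if k = i then ((s * a : ℤ) : ℚ) * v i - ((1 : ℤ) : ℚ) * v j else if k = j then
            ((1 : ℤ) : ℚ) * v j - ((-(t * b) : ℤ) : ℚ) * v i else v k)
      refine ⟨if k = i then s * z i - b * z j else if k = j then a * z j + t * z i else z k, ?_⟩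
      rw [← hzi, ← hzj]
      split_ifs with h1 h2
      · rw [h1, ha']; push_cast; ring
      · rw [h2, hb']; push_cast; ring
      · rw [← hzk, if_neg h1, if_neg h2]

/-- The computation is coordinatewise: m_i generates the ideal of those z with z c_i ∈ ℤ a_i. -/
theorem relIndex_box {n : ℕ} {a c : Fin n → ℚ} {m : Fin n → ℕ}
    (h : ∀ i, ∀ z : ℤ, (∃ w : ℤ, w * a i = z * c i) ↔ (m i : ℤ) ∣ z) :
    (box a).relIndex (box c) = ∏ i, m i := by
  let φ : (Fin n → ℤ) →+ (Fin n → ℚ) :=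
    { toFun := fun z i => z i * c i
      map_zero' := by ext; simp
      map_add' := fun z w => by ext; simp [add_mul] }
  have hr : box c = φ.range := by
    ext v
    rw [mem_box, AddMonoidHom.mem_range]
    constructor
    · intro hv
      choose z hz using hv
      exact ⟨z, funext hz⟩
    · rintro ⟨z, rfl⟩ i
      exact ⟨z i, rfl⟩
  have hc : (box a).comap φ = AddSubgroup.pi Set.univ fun i => AddSubgroup.zmultiples (m i : ℤ) := by
    ext z
    rw [AddSubgroup.mem_comap, mem_box]
    simp only [AddSubgroup.mem_pi, Set.mem_univ, true_imp_iff, Int.mem_zmultiples_iff]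
    exact forall_congr' fun i => h i (z i)
  rw [hr, ← AddSubgroup.index_comap, hc, AddSubgroup.index_pi]
  exact Finset.prod_congr rfl fun i _ => by simp [Int.index_zmultiples]

theorem nsmulLE_box {n : ℕ} {a c : Fin n → ℚ} {m : Fin n → ℕ}
    (h : ∀ i, ∀ z : ℤ, (∃ w : ℤ, w * a i = z * c i) ↔ (m i : ℤ) ∣ z) (r : ℕ) :
    NsmulLE r (box c) (box a) ↔ ∀ i, m i ∣ r := by
  constructor
  · intro H i
    have h1 := mem_box.1 (H c (mem_box.2 fun k => ⟨1, by simp⟩)) i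
    rw [← Int.natCast_dvd_natCast, ← h]
    simpa using h1
  · intro H v hv
    rw [mem_box] at hv ⊢
    intro i
    obtain ⟨z, hz⟩ := hv i
    have := (h i (r * z)).2 ((Int.natCast_dvd_natCast.2 (H i)).mul_right z)
    obtain ⟨w, hw⟩ := this
    refine ⟨w, ?_⟩
    rw [hw, Pi.smul_apply, ← hz]
    push_cast
    simp [mul_assoc]

theorem exists_mul_div_iff {ν δ : ℕ} (hδ : δ ≠ 0) (hc : ν.Coprime δ) (z : ℤ) :
    (∃ w : ℤ, (w : ℚ) * (ν / δ) = z * 1) ↔ (ν : ℤ) ∣ z := by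
  have hδ' : (δ : ℚ) ≠ 0 := by exact_mod_cast hδ
  constructor
  · rintro ⟨w, hw⟩
    have h1 : (w : ℚ) * ν = z * δ := by field_simp at hw; linarith
    have h2 : w * ν = z * δ := by exact_mod_cast h1
    exact (Nat.isCoprime_iff_coprime.2 hc).dvd_of_dvd_mul_right ⟨w, by rw [← h2, mul_comm]⟩
  · rintro ⟨k, rfl⟩
    exact ⟨k * δ, by push_cast; field_simp⟩

theorem exists_mul_one_iff {ν δ : ℕ} (hδ : δ ≠ 0) (hc : ν.Coprime δ) (z : ℤ) :
    (∃ w : ℤ, (w : ℚ) * 1 = z * (ν / δ)) ↔ (δ : ℤ) ∣ z := by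
  have hδ' : (δ : ℚ) ≠ 0 := by exact_mod_cast hδ
  constructor
  · rintro ⟨w, hw⟩
    have h1 : (w : ℚ) * δ = z * ν := by field_simp at hw; linarith
    have h2 : w * δ = z * ν := by exact_mod_cast h1
    exact (Nat.isCoprime_iff_coprime.2 hc.symm).dvd_of_dvd_mul_right ⟨w, by rw [← h2, mul_comm]⟩
  · rintro ⟨k, rfl⟩
    exact ⟨k * ν, by push_cast; field_simp⟩

theorem relIndex_box_stdLat {n : ℕ} (d : Fin n → ℕ) :
    (box fun i => (d i : ℚ)).relIndex (stdLat n) = ∏ i, d i :=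
  relIndex_box fun i z => by simpa using exists_mul_div_iff one_ne_zero (Nat.coprime_one_right (d i)) z

/-- Smith normal form of a sublattice of finite index: the rows of γ are a basis of ℤ^n of which
suitable multiples form a basis of H. Divisibility of the d_i is arranged afterwards. -/
theorem exists_box_of_le {n : ℕ} {H : AddSubgroup (Fin n → ℚ)} (hH : H ≤ stdLat n)
    (hi : H.relIndex (stdLat n) ≠ 0) :
    ∃ d : Fin n → ℕ, (∀ i, 0 < d i) ∧ ∃ γ ∈ lam n, H = act γ (box fun i => (d i : ℚ)) := by
  let φ : (Fin n → ℤ) →+ (Fin n → ℚ) :=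
    { toFun := fun z i => z i
      map_zero' := by ext; simp
      map_add' := fun z w => by ext; simp }
  have hr : stdLat n = φ.range := by
    ext v
    rw [mem_stdLat, AddMonoidHom.mem_range]
    constructor
    · intro hv
      choose z hz using hv
      exact ⟨z, funext hz⟩
    · rintro ⟨z, rfl⟩ i
      exact ⟨z i, rfl⟩
  let N : Submodule ℤ (Fin n → ℤ) := AddSubgroup.toIntSubmodule (H.comap φ)
  have hN : ∀ z, z ∈ N ↔ φ z ∈ H := fun z => Iff.rfl
  have hfin : Finite ((Fin n → ℤ) ⧸ N) := by
    rw [hr, ← AddSubgroup.index_comap] at hi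
    have : (H.comap φ).FiniteIndex := ⟨hi⟩
    exact AddSubgroup.finite_quotient_of_finiteIndex (H := H.comap φ)
  obtain ⟨b, a, ab, hab⟩ := Submodule.exists_smith_normal_form_of_rank_eq
    (Pi.basisFun ℤ (Fin n)) ((Submodule.finiteQuotient_iff N).1 hfin)
  have hdet : IsUnit (Matrix.of b).det := by
    have := (Pi.basisFun ℤ (Fin n)).isUnit_det b
    rwa [Module.Basis.det_apply, ← det_transpose] at this
  let γ : GL (Fin n) ℤ := GeneralLinearGroup.mk'' (Matrix.of b) hdet
  have hγ : ∀ z : Fin n → ℤ, rmul (GeneralLinearGroup.map (Int.castRingHom ℚ) γ) (φ z) =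
      φ (∑ i, z i • b i) := by
    intro z
    ext j
    change ((φ z) ᵥ* ((Matrix.of b).map (Int.castRingHom ℚ))) j = ((∑ i, z i • b i) j : ℤ)
    simp [vecMul, dotProduct, φ]
  refine ⟨fun i => (a i).natAbs, fun i => Int.natAbs_pos.2 fun h0 => ab.ne_zero i ?_,
    GeneralLinearGroup.map (Int.castRingHom ℚ) γ, ⟨γ, rfl⟩, ?_⟩
  · ext1
    rw [hab, h0, zero_smul]; rfl
  · ext v
    rw [mem_act]
    constructor
    · intro hv
      obtain ⟨z, rfl⟩ := hr.le (hH hv)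
      have hz := congrArg (Subtype.val) (ab.sum_repr ⟨z, hv⟩)
      refine ⟨φ fun i => ab.repr ⟨z, hv⟩ i * a i, mem_box.2 fun i => ?_, ?_⟩
      · refine ⟨ab.repr ⟨z, hv⟩ i * (a i).sign, ?_⟩
        change _ = ((ab.repr ⟨z, hv⟩ i * a i : ℤ) : ℚ)
        conv_rhs => rw [← Int.sign_mul_natAbs (a i)]
        rw [Int.cast_mul, Int.cast_mul, Int.cast_mul, Int.cast_natCast, mul_assoc]
      · rw [hγ]
        congr 1
        simp only [Submodule.coe_sum, Submodule.coe_smul, hab] at hz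
        simpa only [mul_smul] using hz
    · rintro ⟨w, hw, rfl⟩
      rw [mem_box] at hw
      choose z hz using hw
      have : w = φ fun i => (z i * (a i).sign) * a i := by
        ext i
        rw [← hz]
        change _ = ((z i * (a i).sign * a i : ℤ) : ℚ)
        rw [mul_assoc, Int.sign_mul_self_eq_natAbs, Int.cast_mul, Int.cast_natCast]
      rw [this, hγ, ← hN]
      refine N.sum_mem fun i _ => ?_
      rw [mul_smul, ← hab]
      exact N.smul_mem _ (ab i).2

/-- With a = gx and b = gy, the difference gcd + lcm - a - b is g(x - 1)(y - 1), which is positive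
unless x or y is 1. -/
theorem dvd_or_dvd_of_gcd_add_lcm_le {a b : ℕ} (ha : 0 < a) (hb : 0 < b)
    (h : Nat.gcd a b + Nat.lcm a b ≤ a + b) : a ∣ b ∨ b ∣ a := by
  obtain ⟨x, hx⟩ := Nat.gcd_dvd_left a b
  obtain ⟨y, hy⟩ := Nat.gcd_dvd_right a b
  have hg : 0 < Nat.gcd a b := Nat.gcd_pos_of_pos_left _ ha
  have hm := Nat.gcd_mul_lcm a b
  have hl := Nat.lcm_pos ha hb
  set g := Nat.gcd a b
  set l := Nat.lcm a b
  have hl' : l = g * (x * y) := by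
    apply Nat.eq_of_mul_eq_mul_left hg
    rw [hm, hx, hy]; ring
  have hx0 : 0 < x := by
    rcases Nat.eq_zero_or_pos x with h0 | h0
    · simp [h0] at hx; omega
    · exact h0
  have hy0 : 0 < y := by
    rcases Nat.eq_zero_or_pos y with h0 | h0
    · simp [h0] at hy; omega
    · exact h0
  have h2 : 1 + x * y ≤ x + y := by
    rw [hl', hx, hy] at h
    apply Nat.le_of_mul_le_mul_left _ hg
    linarith
  rcases Nat.lt_or_ge 1 x with h3 | h3
  · rcases Nat.lt_or_ge 1 y with h4 | h4
    · exfalso; nlinarith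
    · right
      obtain rfl : y = 1 := by omega
      exact ⟨x, by rw [mul_one] at hy; rw [hy]; exact hx⟩
  · left
    obtain rfl : x = 1 := by omega
    exact ⟨y, by rw [mul_one] at hx; rw [hx]; exact hy⟩

/-- Among all diagonal forms of H one with maximal ∑ d_i is taken; the sums are bounded because each
d_i divides the index. Replacing a pair by its gcd and lcm would increase the sum unless one of the
two divides the other, so all d_i are comparable under divisibility, and sorting them gives a chain.
-/
theorem exists_box_of_le_of_dvd {n : ℕ} {H : AddSubgroup (Fin n → ℚ)} (hH : H ≤ stdLat n)
    (hi : H.relIndex (stdLat n) ≠ 0) :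
    ∃ d : Fin n → ℕ, (∀ i, 0 < d i) ∧ (∀ i j, i ≤ j → d i ∣ d j) ∧
      ∃ γ ∈ lam n, H = act γ (box fun i => (d i : ℚ)) := by
  set S : Set (Fin n → ℕ) :=
    {d | (∀ i, 0 < d i) ∧ ∃ γ ∈ lam n, H = act γ (box fun i => (d i : ℚ))} with hS
  set B := n * H.relIndex (stdLat n) with hB
  have hbd : ∀ d ∈ S, ∑ i, d i ≤ B := by
    rintro d ⟨hd, γ, hγ, rfl⟩
    have hprod : ∏ i, d i = (act γ (box fun i => (d i : ℚ))).relIndex (stdLat n) := by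
      rw [← relIndex_box_stdLat, ← relIndex_act γ, act_of_mem_lam hγ]
    rw [hB, ← hprod]
    calc ∑ i, d i ≤ ∑ _i : Fin n, ∏ k, d k := Finset.sum_le_sum fun i _ =>
          Nat.le_of_dvd (Finset.prod_pos fun k _ => hd k)
            (Finset.dvd_prod_of_mem d (Finset.mem_univ i))
      _ = n * ∏ k, d k := by simp
  have hne : S.Nonempty := exists_box_of_le hH hi
  let W := (measure fun d : Fin n → ℕ => B - ∑ i, d i).wf
  set d := W.min S hne with hd
  have hdS : d ∈ S := W.min_mem S hne
  have hmax : ∀ d' ∈ S, ∑ i, d' i ≤ ∑ i, d i := by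
    intro d' hd'
    have h1 : ¬ (B - ∑ i, d' i < B - ∑ i, d i) := W.not_lt_min S hd'
    have h2 := hbd d' hd'
    have h3 := hbd d hdS
    omega
  obtain ⟨hpos, γ, hγ, hHγ⟩ := hdS
  have hcomp : ∀ i j, d i ∣ d j ∨ d j ∣ d i := by
    intro i j
    by_cases hij : i = j
    · subst hij; exact Or.inl dvd_rfl
    obtain ⟨γ', hγ', h'⟩ := exists_gcd_lcm hij d (hpos i)
    refine dvd_or_dvd_of_gcd_add_lcm_le (hpos i) (hpos j) ?_
    have hle := hmax (fun k => if k = i then Nat.gcd (d i) (d j)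
      else if k = j then Nat.lcm (d i) (d j) else d k) ⟨fun k => ?_, γ'⁻¹ * γ,
        (lam n).mul_mem ((lam n).inv_mem hγ') hγ, ?_⟩
    · have e1 : ∀ f : Fin n → ℕ, ∑ k, f k =
          f i + (f j + ∑ k ∈ (Finset.univ.erase i).erase j, f k) := by
        intro f
        rw [Finset.add_sum_erase _ f (by simp [Ne.symm hij]), Finset.add_sum_erase _ f (by simp)]
      rw [e1, e1 d] at hle
      rw [Finset.sum_congr rfl (s₁ := (Finset.univ.erase i).erase j) (g := fun k => d k)] at hle
      · simp only [if_true, if_neg (Ne.symm hij)] at hle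
        omega
      · intro k hk
        simp only [Finset.mem_erase] at hk
        rw [if_neg hk.2.1, if_neg hk.1]
    · have := hpos k
      beta_reduce
      split_ifs
      · exact Nat.gcd_pos_of_pos_left _ (hpos i)
      · exact Nat.lcm_pos (hpos i) (hpos j)
      · exact this
    · rw [act_mul, ← h', act_inv_act, hHγ]
  obtain ⟨π, hπ, hact⟩ := exists_perm (Tuple.sort d)
  refine ⟨d ∘ Tuple.sort d, fun i => hpos _, fun i j hij => ?_, π⁻¹ * γ,
    (lam n).mul_mem ((lam n).inv_mem hπ) hγ, ?_⟩
  · rcases hcomp (Tuple.sort d i) (Tuple.sort d j) with h | h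
    · exact h
    -- If the later entry divides the earlier one, monotonicity forces the two to be equal.
    · have h1 := Tuple.monotone_sort d hij
      have h2 := Nat.le_of_dvd (hpos _) h
      simp only [Function.comp] at h1 ⊢
      rw [le_antisymm h1 h2]
  · rw [act_mul, hHγ]
    congr 1
    have := hact fun i => (d i : ℚ)
    change _ = act π⁻¹ (box ((fun i => (d i : ℚ)) ∘ Tuple.sort d))
    rw [← this, act_inv_act]

theorem rmul_scalar {n : ℕ} (r : ℚˣ) (v : Fin n → ℚ) :
    rmul (GeneralLinearGroup.scalar (Fin n) r) v = (r : ℚ) • v := by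
  change v ᵥ* (Matrix.scalar (Fin n) (r : ℚ)) = _
  ext i
  simp [Matrix.scalar_apply, vecMul_diagonal, mul_comm]

theorem act_scalar_box {n : ℕ} (r : ℚˣ) (a : Fin n → ℚ) :
    act (GeneralLinearGroup.scalar (Fin n) r) (box a) = box fun i => (r : ℚ) * a i := by
  ext v
  rw [mem_act]
  constructor
  · rintro ⟨w, hw, rfl⟩
    rw [mem_box] at hw ⊢
    intro i
    obtain ⟨z, hz⟩ := hw i
    exact ⟨z, by rw [rmul_scalar, Pi.smul_apply, ← hz, smul_eq_mul]; ring⟩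
  · intro hv
    rw [mem_box] at hv
    refine ⟨((r⁻¹ : ℚˣ) : ℚ) • v, mem_box.2 fun i => ?_, ?_⟩
    · obtain ⟨z, hz⟩ := hv i
      refine ⟨z, ?_⟩
      rw [Pi.smul_apply, ← hz, smul_eq_mul, mul_left_comm, Units.inv_mul_cancel_left]
    · rw [rmul_scalar, smul_smul, Units.mul_inv, one_smul]

/-- The elementary divisors `ν_i / δ_i` of a lattice: reduced fractions, each an integral multiple
of the previous one. -/
structure IsDivisorChain {n : ℕ} (ν δ : Fin n → ℕ) : Prop where
  num_pos : ∀ i, 0 < ν i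
  den_pos : ∀ i, 0 < δ i
  coprime : ∀ i, (ν i).Coprime (δ i)
  num_dvd : ∀ i j, i ≤ j → ν i ∣ ν j
  den_dvd : ∀ i j, i ≤ j → δ j ∣ δ i

/-- A multiple N K lies in ℤ^n and has a diagonal form d with d_i dividing d_j for i ≤ j. The
fractions d_i / N are then reduced, and coprimality splits the divisibility into one for numerators
and a reversed one for denominators. -/
theorem exists_divisorChain {n : ℕ} {K : AddSubgroup (Fin n → ℚ)} (h : K.relIndex (stdLat n) ≠ 0)
    (h' : (stdLat n).relIndex K ≠ 0) :
    ∃ ν δ : Fin n → ℕ, IsDivisorChain ν δ ∧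
      ∃ γ ∈ lam n, K = act γ (box fun i => (ν i : ℚ) / δ i) := by
  -- The factorial is divisible by every positive integer up to [K : K ∩ ℤ^n], hence by the order of
  -- each element of the quotient.
  set N := ((stdLat n).relIndex K).factorial with hN
  have hN0 : 0 < N := Nat.factorial_pos _
  have hNQ : (N : ℚ) ≠ 0 := by exact_mod_cast hN0.ne'
  let r : ℚˣ := Units.mk0 (N : ℚ) hNQ
  set s : GL (Fin n) ℚ := GeneralLinearGroup.scalar (Fin n) r with hs
  have hle : act s K ≤ stdLat n := by
    rintro _ ⟨v, hv, rfl⟩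
    have h1 := AddSubgroup.nsmul_mem_of_relIndex_ne_zero_of_dvd h' hv (n := N)
      fun m hm hm' => Nat.dvd_factorial hm hm'
    change rmul s v ∈ _
    rw [hs, rmul_scalar]
    have := h1.1
    rwa [← Nat.cast_smul_eq_nsmul ℚ] at this
  have hs0 : (act s (stdLat n)).relIndex (stdLat n) ≠ 0 := by
    rw [hs, stdLat, act_scalar_box]
    have := relIndex_box_stdLat fun _ : Fin n => N
    rw [show (box fun i : Fin n => (r : ℚ) * 1) = box fun _ => (N : ℚ) by simp [r]]
    change AddSubgroup.relIndex _ (stdLat n) ≠ 0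
    rw [this]
    exact Finset.prod_ne_zero_iff.2 fun _ _ => hN0.ne'
  have hi : (act s K).relIndex (stdLat n) ≠ 0 := by
    refine AddSubgroup.relIndex_ne_zero_trans (K := act s (stdLat n)) ?_ hs0
    rwa [relIndex_act]
  obtain ⟨d, hd, hdvd, γ, hγ, hK⟩ := exists_box_of_le_of_dvd hle hi
  choose ν δ hc h1 h2 using fun i => Nat.exists_coprime (d i) N
  have hg : ∀ i, 0 < Nat.gcd (d i) N := fun i => Nat.gcd_pos_of_pos_left _ (hd i)
  have hν : ∀ i, 0 < ν i := fun i => Nat.pos_of_ne_zero fun h0 => by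
    have := h1 i; rw [h0, zero_mul] at this; exact (hd i).ne' this
  have hδ : ∀ i, 0 < δ i := fun i => Nat.pos_of_ne_zero fun h0 => by
    have := h2 i; rw [h0, zero_mul] at this; exact hN0.ne' this
  have hq : ∀ i, (d i : ℚ) / N = (ν i : ℚ) / δ i := by
    intro i
    have hg' : ((Nat.gcd (d i) N : ℕ) : ℚ) ≠ 0 := by exact_mod_cast (hg i).ne'
    have e1 : (d i : ℚ) = ν i * (Nat.gcd (d i) N : ℕ) := by exact_mod_cast h1 i
    have e2 : (N : ℚ) = δ i * (Nat.gcd (d i) N : ℕ) := by exact_mod_cast h2 i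
    calc (d i : ℚ) / N = (ν i * (Nat.gcd (d i) N : ℕ)) / (δ i * (Nat.gcd (d i) N : ℕ)) := by
          rw [← e1, ← e2]
      _ = _ := mul_div_mul_right _ _ hg'
  have hcross : ∀ i j, i ≤ j → ∃ k, ν j * δ i = k * ν i * δ j := by
    intro i j hij
    obtain ⟨k, hk⟩ := hdvd i j hij
    refine ⟨k, ?_⟩
    have e : (ν j : ℚ) / δ j = k * (ν i / δ i) := by
      rw [← hq, ← hq, hk]; push_cast; ring
    have hi : (δ i : ℚ) ≠ 0 := by exact_mod_cast (hδ i).ne'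
    have hj : (δ j : ℚ) ≠ 0 := by exact_mod_cast (hδ j).ne'
    field_simp at e
    have e' : (ν j : ℚ) * δ i = k * ν i * δ j := by linarith
    exact_mod_cast e'
  refine ⟨ν, δ, ⟨hν, hδ, hc, fun i j hij => ?_, fun i j hij => ?_⟩, γ, hγ, ?_⟩
  · obtain ⟨k, hk⟩ := hcross i j hij
    exact (hc i).dvd_of_dvd_mul_right ⟨k * δ j, by rw [hk]; ring⟩
  · obtain ⟨k, hk⟩ := hcross i j hij
    exact (hc j).symm.dvd_of_dvd_mul_left ⟨k * ν i, by rw [hk]; ring⟩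
  · apply act_injective s
    rw [hK, ← act_mul, ← (GeneralLinearGroup.scalar_commute r γ : s * γ = γ * s), act_mul,
      act_scalar_box]
    congr 2
    ext i
    rw [← hq]
    change (d i : ℚ) = N * (d i / N)
    field_simp

/-! ### Relative positions recognised by indices and exponents -/

/-- The tuple `(1, …, 1, c, …, c)` with `l` entries `c`. -/
def topVec (n l c : ℕ) : Fin n → ℕ := fun i => if (i : ℕ) + l < n then 1 else c

/-- The tuple `(b, …, b, 1, …, 1)` with `k` entries `b`. -/
def botVec (n k b : ℕ) : Fin n → ℕ := fun i => if (i : ℕ) < k then b else 1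

/-- The relation on pairs `(H, K)` given by conditions on `[H : H ∩ K]` and on `p H ≤ K`, and on
`[K : H ∩ K]` and on `p K ≤ H`. -/
def IndexRel {V : Type*} [AddCommGroup V] (p : ℕ) (Φ Ψ : ℕ → Prop → Prop) (H K : AddSubgroup V) :
    Prop :=
  Φ (K.relIndex H) (NsmulLE p H K) ∧ Ψ (H.relIndex K) (NsmulLE p K H)

theorem isInvariant_indexRel {n : ℕ} (p : ℕ) (Φ Ψ : ℕ → Prop → Prop) :
    IsInvariant (n := n) (IndexRel p Φ Ψ) := by
  intro x H K
  rw [IndexRel, IndexRel, relIndex_act, relIndex_act, propext (nsmulLE_act x p H K),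
    propext (nsmulLE_act x p K H)]

/-- The condition `Φ` on the product of a divisor chain `ν` and on the divisibility of `p` by its
terms means that `ν = (1, …, 1, c, …, c)`. -/
structure Detects (n l c p : ℕ) (Φ : ℕ → Prop → Prop) : Prop where
  iff : ∀ ν : Fin n → ℕ, (∀ i, 0 < ν i) → (∀ i j, i ≤ j → ν i ∣ ν j) →
    (Φ (∏ i, ν i) (∀ i, ν i ∣ p) ↔ ν = topVec n l c)
  ne_zero : ∀ i P, Φ i P → i ≠ 0
  pos : 0 < c

theorem topVec_dvd {n l c : ℕ} (i j : Fin n) (h : i ≤ j) : topVec n l c i ∣ topVec n l c j := by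
  have : (i : ℕ) ≤ j := h
  unfold topVec
  split_ifs
  · exact dvd_rfl
  · exact one_dvd _
  · omega
  · exact dvd_rfl

theorem topVec_pos {n l c : ℕ} (hc : 0 < c) (i : Fin n) : 0 < topVec n l c i := by
  unfold topVec
  split_ifs
  · exact one_pos
  · exact hc

theorem botVec_pos {n k b : ℕ} (hb : 0 < b) (i : Fin n) : 0 < botVec n k b i := by
  unfold botVec
  split_ifs
  · exact hb
  · exact one_pos

theorem topVec_rev {n k b : ℕ} (i : Fin n) : topVec n k b i.rev = botVec n k b i := by
  unfold topVec botVec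
  rw [Fin.val_rev]
  split_ifs <;> first | rfl | omega

theorem Detects.iff_rev {n k b p : ℕ} {Ψ : ℕ → Prop → Prop} (h : Detects n k b p Ψ)
    (δ : Fin n → ℕ) (hpos : ∀ i, 0 < δ i) (hδ : ∀ i j, i ≤ j → δ j ∣ δ i) :
    Ψ (∏ i, δ i) (∀ i, δ i ∣ p) ↔ δ = botVec n k b := by
  have h1 := h.iff (fun i => δ i.rev) (fun i => hpos _)
    fun i j hij => hδ _ _ (Fin.rev_le_rev.2 hij)
  have h2 : ∏ i : Fin n, δ i.rev = ∏ i, δ i := Equiv.prod_comp Fin.revPerm δ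
  have h3 : (∀ i : Fin n, δ i.rev ∣ p) ↔ ∀ i, δ i ∣ p :=
    ⟨fun H i => by simpa using H i.rev, fun H i => H _⟩
  rw [h2, propext h3] at h1
  rw [h1]
  constructor
  · intro h4
    ext i
    have := congrFun h4 i.rev
    rwa [Fin.rev_rev, topVec_rev] at this
  · rintro rfl
    ext i
    rw [← topVec_rev, Fin.rev_rev]

theorem indexRel_box {n p : ℕ} {Φ Ψ : ℕ → Prop → Prop} {ν δ : Fin n → ℕ}
    (hδ : ∀ i, 0 < δ i) (hc : ∀ i, (ν i).Coprime (δ i)) :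
    IndexRel p Φ Ψ (stdLat n) (box fun i => (ν i : ℚ) / δ i) ↔
      Φ (∏ i, ν i) (∀ i, ν i ∣ p) ∧ Ψ (∏ i, δ i) (∀ i, δ i ∣ p) := by
  have h1 := fun i z => exists_mul_div_iff (hδ i).ne' (hc i) z
  have h2 := fun i z => exists_mul_one_iff (hδ i).ne' (hc i) z
  rw [IndexRel, stdLat, relIndex_box h1, relIndex_box h2, propext (nsmulLE_box h1 p),
    propext (nsmulLE_box h2 p)]

/-- For K with elementary divisors ν_i / δ_i the two indices are ∏ ν_i and ∏ δ_i, and p kills the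
quotients when all ν_i, respectively all δ_i, divide p. So Φ determines the numerators and Ψ the
denominators; k + l ≤ n keeps the two nontrivial blocks disjoint. -/
theorem indexRel_stdLat_iff {n k l b c p : ℕ} {Φ Ψ : ℕ → Prop → Prop} (hkl : k + l ≤ n)
    (hΦ : Detects n l c p Φ) (hΨ : Detects n k b p Ψ) (K : AddSubgroup (Fin n → ℚ)) :
    IndexRel p Φ Ψ (stdLat n) K ↔
      ∃ γ ∈ lam n, K = act γ (box fun i => (topVec n l c i : ℚ) / botVec n k b i) := by
  have hδ := fun i => botVec_pos (n := n) (k := k) hΨ.pos i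
  have hcop : ∀ i, (topVec n l c i).Coprime (botVec n k b i) := by
    intro i
    unfold topVec botVec
    split_ifs
    · exact Nat.coprime_one_left _
    · exact Nat.coprime_one_left _
    · omega
    · exact Nat.coprime_one_right _
  constructor
  · intro h
    obtain ⟨ν, δ, hch, γ, hγ, rfl⟩ := exists_divisorChain (hΦ.ne_zero _ _ h.1) (hΨ.ne_zero _ _ h.2)
    refine ⟨γ, hγ, ?_⟩
    have h' : IndexRel p Φ Ψ (act γ (stdLat n)) (act γ (box fun i => (ν i : ℚ) / δ i)) := by
      rwa [act_of_mem_lam hγ]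
    rw [isInvariant_indexRel, indexRel_box hch.den_pos hch.coprime,
      hΦ.iff ν hch.num_pos hch.num_dvd, hΨ.iff_rev δ hch.den_pos hch.den_dvd] at h'
    rw [h'.1, h'.2]
  · rintro ⟨γ, hγ, rfl⟩
    rw [← act_of_mem_lam hγ, isInvariant_indexRel, indexRel_box hδ hcop]
    refine ⟨(hΦ.iff _ (topVec_pos hΦ.pos) topVec_dvd).2 rfl, (hΨ.iff_rev _ hδ ?_).2 rfl⟩
    intro i j hij
    rw [← topVec_rev, ← topVec_rev]
    exact topVec_dvd _ _ (Fin.rev_le_rev.2 hij)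

theorem act_diagGL {n : ℕ} (d : Fin n → ℕ+) :
    act (diagGL d) (stdLat n) = box fun i => ((d i : ℕ) : ℚ) := by
  have hr : ∀ v i, rmul (diagGL d) v i = v i * ((d i : ℕ) : ℚ) := by
    intro v i
    change (v ᵥ* Matrix.diagonal fun i => ((d i : ℕ) : ℚ)) i = _
    rw [vecMul_diagonal]
  ext v
  rw [mem_act, mem_box]
  constructor
  · rintro ⟨w, hw, rfl⟩ i
    obtain ⟨z, hz⟩ := mem_stdLat.1 hw i
    exact ⟨z, by rw [hr, hz]⟩
  · intro hv
    choose z hz using hv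
    exact ⟨fun i => z i, mem_stdLat.2 fun i => ⟨z i, rfl⟩, funext fun i => by rw [hr, hz]⟩

/-- A representative, up to scalars, of the double coset of `diag(1, …, 1, b, …, b, bc, …, bc)`. -/
noncomputable def unitBlocks (n k l : ℕ) (b c : ℕ+) : GL (Fin n) ℚ :=
  GeneralLinearGroup.scalar (Fin n) (Units.mk0 ((b : ℕ) : ℚ) (Nat.cast_ne_zero.2 b.ne_zero))⁻¹ *
    diagGL (blocks n k l 1 b (b * c))

theorem T_eq_hecke (n k l : ℕ) (b c : ℕ+) :
    T n k l 1 b (b * c) = hecke (unitBlocks n k l b c) := (hecke_smul _ _).symm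

theorem mem_orbitLat_unitBlocks {n k l : ℕ} {b c : ℕ+} (hkl : k + l ≤ n)
    (K : AddSubgroup (Fin n → ℚ)) :
    K ∈ orbitLat (unitBlocks n k l b c) ↔
      ∃ γ ∈ lam n, K = act γ (box fun i => (topVec n l c i : ℚ) / botVec n k b i) := by
  have : act (unitBlocks n k l b c) (stdLat n) =
      box fun i => (topVec n l c i : ℚ) / botVec n k b i := by
    rw [unitBlocks, GeneralLinearGroup.scalar_commute, act_mul, act_diagGL, act_scalar_box]
    congr 1
    ext i
    have hb : ((b : ℕ) : ℚ) ≠ 0 := Nat.cast_ne_zero.2 b.ne_zero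
    simp only [Units.val_inv_eq_inv_val, Units.val_mk0, blocks, topVec, botVec]
    split_ifs <;> first | omega | (push_cast; field_simp)
  constructor
  · rintro ⟨γ, hγ, rfl⟩
    exact ⟨γ, hγ, by rw [act_mul, this]⟩
  · rintro ⟨γ, hγ, rfl⟩
    exact ⟨γ, hγ, by rw [act_mul, this]⟩

theorem indexRel_iff_mem_orbitLat {n k l p : ℕ} {b c : ℕ+} {Φ Ψ : ℕ → Prop → Prop}
    (hkl : k + l ≤ n) (hΦ : Detects n l c p Φ) (hΨ : Detects n k b p Ψ)
    (K : AddSubgroup (Fin n → ℚ)) :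
    IndexRel p Φ Ψ (stdLat n) K ↔ K ∈ orbitLat (unitBlocks n k l b c) := by
  rw [indexRel_stdLat_iff hkl hΦ hΨ, mem_orbitLat_unitBlocks hkl]

theorem detects_one {n p : ℕ} : Detects n 0 1 p fun i _ => i = 1 where
  iff ν _ _ := by
    have h : topVec n 0 1 = fun _ => 1 := by ext i; simp [topVec]
    rw [h]
    constructor
    · intro h1
      ext i
      exact Nat.dvd_one.1 (h1 ▸ Finset.dvd_prod_of_mem ν (Finset.mem_univ i))
    · rintro rfl
      simp
  ne_zero i _ h := by rw [h]; exact one_ne_zero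
  pos := one_pos

theorem eq_topVec_iff {m l c : ℕ} (ν : Fin (m + 2) → ℕ) : ν = topVec (m + 2) l c ↔
    (∀ i : Fin m, ν i.castSucc.castSucc = topVec (m + 2) l c i.castSucc.castSucc) ∧
      ν (Fin.last m).castSucc = topVec (m + 2) l c (Fin.last m).castSucc ∧
      ν (Fin.last (m + 1)) = topVec (m + 2) l c (Fin.last (m + 1)) := by
  constructor
  · rintro rfl
    exact ⟨fun _ => rfl, rfl, rfl⟩
  · rintro ⟨h1, h2, h3⟩
    ext i
    refine Fin.lastCases h3 (fun j => ?_) i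
    exact Fin.lastCases h2 h1 j

theorem topVec_castSucc_castSucc {m l c : ℕ} (hl : l ≤ 2) (i : Fin m) :
    topVec (m + 2) l c i.castSucc.castSucc = 1 := by
  have := i.2
  exact if_pos (by simp only [Fin.val_castSucc]; omega)

theorem prod_eq_one_of_dvd {m : ℕ} {a : Fin m → ℕ} (h : ∀ i, a i ∣ 1) : ∏ i, a i = 1 :=
  Finset.prod_eq_one fun i _ => Nat.dvd_one.1 (h i)

theorem eq_one_of_prod_eq_one {m : ℕ} {a : Fin m → ℕ} (h : ∏ i, a i = 1) (i : Fin m) : a i = 1 :=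
  Nat.dvd_one.1 (h ▸ Finset.dvd_prod_of_mem a (Finset.mem_univ i))

theorem forall_dvd_iff {m p : ℕ} {ν : Fin (m + 2) → ℕ} (hν : ∀ i j, i ≤ j → ν i ∣ ν j) :
    (∀ i, ν i ∣ p) ↔ ν (Fin.last (m + 1)) ∣ p :=
  ⟨fun h => h _, fun h i => (hν i _ (Fin.le_last i)).trans h⟩

theorem detects_squarefree {n N p : ℕ} (hn : 2 ≤ n) (hN : Squarefree N) :
    Detects n 1 N p fun i _ => i = N where
  iff ν hpos hν := by
    obtain ⟨m, rfl⟩ := Nat.exists_eq_add_of_le' hn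
    rw [eq_topVec_iff, Fin.prod_univ_castSucc, Fin.prod_univ_castSucc]
    simp only [topVec_castSucc_castSucc one_le_two]
    have e1 : topVec (m + 2) 1 N (Fin.last m).castSucc = 1 := if_pos (by simp)
    have e2 : topVec (m + 2) 1 N (Fin.last (m + 1)) = N := if_neg (by simp)
    rw [e1, e2]
    constructor
    · intro h
      have hx : ν (Fin.last m).castSucc = 1 := by
        have h1 := hν (Fin.last m).castSucc (Fin.last (m + 1)) (Fin.le_last _)
        -- The second largest term divides the largest, so its square divides the squarefree
        -- product.
        refine Nat.isUnit_iff.1 (hN _ ?_)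
        rw [← h, mul_assoc]
        exact (mul_dvd_mul_left _ h1).mul_left _
      have ha : ∀ i : Fin m, ν i.castSucc.castSucc = 1 := fun i =>
        Nat.dvd_one.1 ((hν _ _ (Fin.castSucc_le_castSucc_iff.2 (Fin.le_last _))).trans hx.dvd)
      refine ⟨ha, hx, ?_⟩
      rw [hx, prod_eq_one_of_dvd fun i => (ha i).dvd] at h
      simpa using h
    · rintro ⟨h1, h2, h3⟩
      rw [h2, h3, prod_eq_one_of_dvd fun i => (h1 i).dvd]
      simp
  ne_zero i _ h := by rw [h]; exact hN.ne_zero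
  pos := Nat.pos_of_ne_zero hN.ne_zero

theorem detects_elementary {n p : ℕ} (hn : 2 ≤ n) (hp : p.Prime) :
    Detects n 2 p p fun i P => i = p ^ 2 ∧ P where
  iff ν hpos hν := by
    obtain ⟨m, rfl⟩ := Nat.exists_eq_add_of_le' hn
    rw [eq_topVec_iff, Fin.prod_univ_castSucc, Fin.prod_univ_castSucc, forall_dvd_iff hν]
    simp only [topVec_castSucc_castSucc le_rfl]
    have e1 : topVec (m + 2) 2 p (Fin.last m).castSucc = p := if_neg (by simp)
    have e2 : topVec (m + 2) 2 p (Fin.last (m + 1)) = p := if_neg (by simp)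
    rw [e1, e2]
    have hp2 : p ^ 2 ≠ 0 := pow_ne_zero _ hp.ne_zero
    constructor
    · rintro ⟨h, hy⟩
      have hxy := hν (Fin.last m).castSucc (Fin.last (m + 1)) (Fin.le_last _)
      have hx : ν (Fin.last m).castSucc = p := by
        rcases (Nat.dvd_prime hp).1 (hxy.trans hy) with hx | hx
        -- If this term were 1, all earlier ones would be too, and the last would be p², which does
        -- not divide p.
        · have ha : ∀ i : Fin m, ν i.castSucc.castSucc ∣ 1 := fun i =>
            (hν _ _ (Fin.castSucc_le_castSucc_iff.2 (Fin.le_last _))).trans hx.dvd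
          rw [hx, prod_eq_one_of_dvd ha, one_mul, one_mul] at h
          rw [h] at hy
          have := Nat.le_of_dvd hp.pos hy
          have := hp.two_le
          exfalso; nlinarith
        · exact hx
      have hy' : ν (Fin.last (m + 1)) = p := Nat.dvd_antisymm hy (hx ▸ hxy)
      rw [hx, hy', mul_assoc, ← sq] at h
      have hA : ∏ i : Fin m, ν i.castSucc.castSucc = 1 :=
        Nat.eq_of_mul_eq_mul_right (Nat.pos_of_ne_zero hp2) (by rw [h, one_mul])
      exact ⟨eq_one_of_prod_eq_one hA, hx, hy'⟩
    · rintro ⟨h1, h2, h3⟩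
      rw [h2, h3, prod_eq_one_of_dvd fun i => (h1 i).dvd]
      exact ⟨by ring, dvd_rfl⟩
  ne_zero i _ h := by rw [h.1]; exact pow_ne_zero _ hp.ne_zero
  pos := hp.pos

theorem detects_cyclic {n p : ℕ} (hn : 2 ≤ n) (hp : p.Prime) :
    Detects n 1 (p ^ 2) p fun i P => i = p ^ 2 ∧ ¬ P where
  iff ν hpos hν := by
    obtain ⟨m, rfl⟩ := Nat.exists_eq_add_of_le' hn
    rw [eq_topVec_iff, Fin.prod_univ_castSucc, Fin.prod_univ_castSucc, forall_dvd_iff hν]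
    simp only [topVec_castSucc_castSucc one_le_two]
    have e1 : topVec (m + 2) 1 (p ^ 2) (Fin.last m).castSucc = 1 := if_pos (by simp)
    have e2 : topVec (m + 2) 1 (p ^ 2) (Fin.last (m + 1)) = p ^ 2 := if_neg (by simp)
    rw [e1, e2]
    have hp2 : p ^ 2 ≠ 0 := pow_ne_zero _ hp.ne_zero
    constructor
    · rintro ⟨h, hy⟩
      have hy' : ν (Fin.last (m + 1)) = p ^ 2 := by
        have h1 : ν (Fin.last (m + 1)) ∣ p ^ 2 := ⟨_, by rw [← h, mul_comm]⟩
        obtain ⟨k, hk, hk'⟩ := (Nat.dvd_prime_pow hp).1 h1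
        interval_cases k
        · simp [hk'] at hy
        · simp [hk'] at hy
        · exact hk'
      rw [hy'] at h
      have hA := Nat.eq_of_mul_eq_mul_right (Nat.pos_of_ne_zero hp2) (h.trans (one_mul _).symm)
      exact ⟨eq_one_of_prod_eq_one (Nat.eq_one_of_mul_eq_one_right hA),
        Nat.eq_one_of_mul_eq_one_left hA, hy'⟩
    · rintro ⟨h1, h2, h3⟩
      rw [h2, h3, prod_eq_one_of_dvd fun i => (h1 i).dvd]
      refine ⟨by ring, fun h => ?_⟩
      have := Nat.le_of_dvd hp.pos h
      have := hp.two_le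
      nlinarith
  ne_zero i _ h := by rw [h.1]; exact pow_ne_zero _ hp.ne_zero
  pos := Nat.pos_of_ne_zero (pow_ne_zero _ hp.ne_zero)

/-! ### Counting subgroups of prime index in an abelian group -/

section Counting

variable {V : Type*} [AddCommGroup V]

theorem ncard_eq_mul_of_fibers {α β : Type*} {S : Set α} {T : Set β} (f : α → β) {c : ℕ}
    (hS : S.Finite) (hT : T.Finite) (hf : ∀ x ∈ S, f x ∈ T)
    (hc : ∀ t ∈ T, {x | x ∈ S ∧ f x = t}.ncard = c) : S.ncard = T.ncard * c := by
  classical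
  rw [Set.ncard_eq_toFinset_card S hS, Set.ncard_eq_toFinset_card T hT,
    Finset.card_eq_sum_card_fiberwise (f := f) (t := hT.toFinset)
      (fun x hx => by simpa using hf x (by simpa using hx)), ← smul_eq_mul, ← Finset.sum_const]
  refine Finset.sum_congr rfl fun t ht => ?_
  rw [← hc t (by simpa using ht), ← Set.ncard_coe_finset]
  congr 1
  ext x
  simp

theorem finite_setOf_addSubgroup_le {L : AddSubgroup V} (hL : (L : Set V).Finite) :
    {P : AddSubgroup V | P ≤ L}.Finite :=
  Set.Finite.of_finite_image (f := fun P : AddSubgroup V => (P : Set V))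
    (hL.finite_subsets.subset (by rintro _ ⟨P, hP, rfl⟩; exact hP)) SetLike.coe_injective.injOn

/-- Every nonzero element of L generates a subgroup of order p, and each such subgroup has p - 1
generators. -/
theorem ncard_addSubgroup_card_eq {p : ℕ} (hp : p.Prime) {L : AddSubgroup V}
    (hL : (L : Set V).Finite) (h : ∀ x ∈ L, p • x = 0) :
    {P : AddSubgroup V | P ≤ L ∧ Nat.card P = p}.ncard * (p - 1) = Nat.card L - 1 := by
  have := Fact.mk hp
  have h1 : ((L : Set V) \ {0}).ncard = Nat.card L - 1 := by
    rw [Set.ncard_sdiff_singleton_of_mem L.zero_mem, ← Nat.card_coe_set_eq]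
    rfl
  rw [← h1]
  refine (ncard_eq_mul_of_fibers (fun x => AddSubgroup.zmultiples x) (hL.subset Set.sdiff_subset)
    ((finite_setOf_addSubgroup_le hL).subset fun P hP => hP.1) ?_ ?_).symm
  · rintro x ⟨hx, hx0⟩
    refine ⟨AddSubgroup.zmultiples_le_of_mem hx, ?_⟩
    rw [Nat.card_zmultiples]
    exact addOrderOf_eq_prime (h x hx) hx0
  · rintro P ⟨hPL, hP⟩
    have h2 : {x | x ∈ (L : Set V) \ {0} ∧ AddSubgroup.zmultiples x = P} = (P : Set V) \ {0} := by
      ext x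
      constructor
      · rintro ⟨⟨-, hx⟩, rfl⟩
        exact ⟨AddSubgroup.mem_zmultiples x, hx⟩
      · rintro ⟨hx, hx0⟩
        refine ⟨⟨hPL hx, hx0⟩, ?_⟩
        have hfin : Finite P := Nat.finite_of_card_ne_zero (by rw [hP]; exact hp.ne_zero)
        refine AddSubgroup.eq_of_le_of_card_ge (AddSubgroup.zmultiples_le_of_mem hx) ?_
        rw [Nat.card_zmultiples, addOrderOf_eq_prime (h x (hPL hx)) hx0, hP]
    rw [h2, Set.ncard_sdiff_singleton_of_mem P.zero_mem, ← Nat.card_coe_set_eq]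
    exact congrArg (· - 1) hP

/-- The correspondence theorem reduces this to counting subgroups of order p in L/M, which is killed
by p. -/
theorem ncard_between_of_nsmulLE {p : ℕ} (hp : p.Prime) {M L : AddSubgroup V} (hML : M ≤ L)
    (hi : M.relIndex L ≠ 0) (h : NsmulLE p L M) :
    {P : AddSubgroup V | M ≤ P ∧ P ≤ L ∧ M.relIndex P = p}.ncard * (p - 1) =
      M.relIndex L - 1 := by
  have hcard : ∀ P : AddSubgroup V, Nat.card (P.map (QuotientAddGroup.mk' M)) = M.relIndex P := by
    intro P
    rw [← AddSubgroup.relIndex_ker, QuotientAddGroup.ker_mk']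
  have hfin : ((L.map (QuotientAddGroup.mk' M) : AddSubgroup (V ⧸ M)) : Set (V ⧸ M)).Finite := by
    have : Finite (L.map (QuotientAddGroup.mk' M)) :=
      Nat.finite_of_card_ne_zero (by rw [hcard]; exact hi)
    exact Set.toFinite _
  rw [← hcard L, ← ncard_addSubgroup_card_eq hp hfin]
  · congr 1
    have hcm : ∀ P : AddSubgroup V, M ≤ P →
        (P.map (QuotientAddGroup.mk' M)).comap (QuotientAddGroup.mk' M) = P := by
      intro P hP
      rw [AddSubgroup.comap_map_eq, QuotientAddGroup.ker_mk', sup_eq_left.2 hP]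
    refine Set.ncard_congr (fun P _ => P.map (QuotientAddGroup.mk' M)) ?_ ?_ ?_
    · rintro P ⟨h1, h2, h3⟩
      exact ⟨AddSubgroup.map_mono h2, by rw [hcard, h3]⟩
    · rintro P Q ⟨hP, -⟩ ⟨hQ, -⟩ hPQ
      rw [← hcm P hP, ← hcm Q hQ]
      exact congrArg _ hPQ
    · rintro Q ⟨hQ, hQ'⟩
      have hm : (Q.comap (QuotientAddGroup.mk' M)).map (QuotientAddGroup.mk' M) = Q :=
        AddSubgroup.map_comap_eq_self_of_surjective (QuotientAddGroup.mk'_surjective M) Q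
      refine ⟨Q.comap (QuotientAddGroup.mk' M), ⟨?_, ?_, ?_⟩, hm⟩
      · conv_lhs => rw [← QuotientAddGroup.ker_mk' M]
        exact AddSubgroup.ker_le_comap _ _
      · rw [← hcm L hML]
        exact AddSubgroup.comap_mono hQ
      · rw [← hcard, hm, hQ']
  · rintro _ ⟨x, hx, rfl⟩
    rw [← map_nsmul]
    exact (QuotientAddGroup.eq_zero_iff _).2 (h x hx)

theorem nsmulLE_relIndex (H K : AddSubgroup V) : NsmulLE (K.relIndex H) H K := by
  intro x hx
  have := (K.addSubgroupOf H).nsmul_index_mem ⟨x, hx⟩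
  rwa [AddSubgroup.mem_addSubgroupOf] at this

theorem eq_or_eq_of_relIndex_prime {p : ℕ} (hp : p.Prime) {P Q H : AddSubgroup V} (hPQ : P ≤ Q)
    (hQH : Q ≤ H) (h : P.relIndex H = p) : Q = P ∨ Q = H := by
  have h1 := AddSubgroup.relIndex_mul_relIndex P Q H hPQ hQH
  rw [h] at h1
  rcases (Nat.dvd_prime hp).1 ⟨_, h1.symm⟩ with h2 | h2
  · exact Or.inl (le_antisymm (AddSubgroup.relIndex_eq_one.1 h2) hPQ)
  · right
    rw [h2] at h1
    exact le_antisymm hQH (AddSubgroup.relIndex_eq_one.1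
      (Nat.eq_of_mul_eq_mul_left hp.pos (h1.trans (mul_one p).symm)))

theorem eq_of_le_of_relIndex_eq {P Q H : AddSubgroup V} (hPQ : P ≤ Q) (hQH : Q ≤ H)
    (h : P.relIndex H = Q.relIndex H) (h0 : Q.relIndex H ≠ 0) : P = Q := by
  have h1 := AddSubgroup.relIndex_mul_relIndex P Q H hPQ hQH
  rw [h] at h1
  exact le_antisymm hPQ (AddSubgroup.relIndex_eq_one.1
    (Nat.eq_of_mul_eq_mul_right (Nat.pos_of_ne_zero h0) (h1.trans (one_mul _).symm)))

theorem eq_of_le_of_relIndex_eq' {P Q H : AddSubgroup V} (hPQ : P ≤ Q) (hQH : Q ≤ H)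
    (h : P.relIndex H = P.relIndex Q) (h0 : P.relIndex Q ≠ 0) : Q = H := by
  have h1 := AddSubgroup.relIndex_mul_relIndex P Q H hPQ hQH
  rw [h] at h1
  exact le_antisymm hQH (AddSubgroup.relIndex_eq_one.1
    (Nat.eq_of_mul_eq_mul_left (Nat.pos_of_ne_zero h0) (h1.trans (mul_one _).symm)))

theorem relIndex_between {p : ℕ} (hp : p.Prime) {M P L : AddSubgroup V} (hMP : M ≤ P)
    (hPL : P ≤ L) (h : M.relIndex L = p ^ 2) : M.relIndex P = p ↔ P.relIndex L = p := by
  have h1 := AddSubgroup.relIndex_mul_relIndex M P L hMP hPL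
  rw [h, sq] at h1
  constructor
  · intro h2
    rw [h2] at h1
    exact Nat.eq_of_mul_eq_mul_left hp.pos h1
  · intro h2
    rw [h2] at h1
    exact Nat.eq_of_mul_eq_mul_right hp.pos h1

/-- The subgroups containing `L` with index `p`. -/
def overgroups (p : ℕ) (L : AddSubgroup V) : Set (AddSubgroup V) := {H | L ≤ H ∧ L.relIndex H = p}

/-- The subgroups of index `p` in `L`. -/
def undergroups (p : ℕ) (L : AddSubgroup V) : Set (AddSubgroup V) := {H | H ≤ L ∧ H.relIndex L = p}

-- If p kills L/M, there are (p² - 1)/(p - 1) = p + 1 choices. Otherwise M + pL has index p in L,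
-- and it is the only choice, because a subgroup of index p contains pL.
open Classical in
theorem ncard_between {p : ℕ} (hp : p.Prime) {M L : AddSubgroup V} (hML : M ≤ L)
    (h : M.relIndex L = p ^ 2) :
    {P | P ∈ undergroups p L ∧ M ≤ P}.ncard = if NsmulLE p L M then p + 1 else 1 := by
  have hp2 : M.relIndex L ≠ 0 := by rw [h]; exact pow_ne_zero _ hp.ne_zero
  split_ifs with hn
  · have h1 := ncard_between_of_nsmulLE hp hML hp2 hn
    have h2 : {P : AddSubgroup V | M ≤ P ∧ P ≤ L ∧ M.relIndex P = p} =
        {P | P ∈ undergroups p L ∧ M ≤ P} := by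
      ext P
      constructor
      · rintro ⟨a, b, c⟩
        exact ⟨⟨b, (relIndex_between hp a b h).1 c⟩, a⟩
      · rintro ⟨⟨b, c⟩, a⟩
        exact ⟨a, b, (relIndex_between hp a b h).2 c⟩
    rw [h2, h] at h1
    have h3 : 0 < p - 1 := Nat.sub_pos_of_lt hp.one_lt
    apply Nat.eq_of_mul_eq_mul_right h3
    rw [h1, ← Nat.sq_sub_sq p 1, one_pow]
  · rw [Set.ncard_eq_one]
    let S : AddSubgroup V := M ⊔ L.map (nsmulAddMonoidHom p)
    have hS : ∀ v ∈ L, p • v ∈ S := fun v hv =>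
      (le_sup_right : _ ≤ S) (AddSubgroup.mem_map_of_mem (nsmulAddMonoidHom p) hv)
    have hMS : M ≤ S := le_sup_left
    have hSL : S ≤ L := by
      refine sup_le hML ?_
      rintro _ ⟨v, hv, rfl⟩
      exact L.nsmul_mem hv p
    have hprod := AddSubgroup.relIndex_mul_relIndex M S L hMS hSL
    rw [h] at hprod
    have hidx : S.relIndex L = p := by
      obtain ⟨k, hk, hk'⟩ := (Nat.dvd_prime_pow hp).1 ⟨_, by rw [mul_comm]; exact hprod.symm⟩
      interval_cases k
      -- If M + pL = L, write v = a + pw with a ∈ M; then pv = pa + p²w lies in M, because p² kills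
      -- L/M.
      · exfalso
        rw [pow_zero, AddSubgroup.relIndex_eq_one] at hk'
        apply hn
        intro v hv
        have h1 : v ∈ S := hk' hv
        obtain ⟨a, ha, _, ⟨w, hw, rfl⟩, rfl⟩ := AddSubgroup.mem_sup.1 h1
        have h2 := nsmulLE_relIndex L M w hw
        rw [h, sq, mul_smul] at h2
        rw [smul_add]
        exact M.add_mem (M.nsmul_mem ha p) h2
      · rwa [pow_one] at hk'
      · exfalso
        rw [hk'] at hprod
        have h1 : M.relIndex S = 1 := Nat.eq_of_mul_eq_mul_right (pow_pos hp.pos 2)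
          (hprod.trans (one_mul _).symm)
        exact hn fun v hv => AddSubgroup.relIndex_eq_one.1 h1 (hS v hv)
    refine ⟨S, ?_⟩
    ext P
    constructor
    · rintro ⟨⟨hPL, hP⟩, hMP⟩
      have hSP : S ≤ P := by
        refine sup_le hMP ?_
        rintro _ ⟨v, hv, rfl⟩
        have := nsmulLE_relIndex L P v hv
        rwa [hP] at this
      exact (eq_of_le_of_relIndex_eq hSP hPL (by rw [hidx, hP]) (by rw [hP]; exact hp.ne_zero)).symm
    · rintro rfl
      exact ⟨⟨hSL, hidx⟩, hMS⟩

/-- `L ∩ H` has index `p` in `L` and in `H`. -/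
def Adj (p : ℕ) (L H : AddSubgroup V) : Prop := H.relIndex L = p ∧ L.relIndex H = p

theorem Adj.symm {p : ℕ} {L H : AddSubgroup V} (h : Adj p L H) : Adj p H L := ⟨h.2, h.1⟩

/-- L ∩ H lies between M and L, whose index is prime; if it were L, then L ≤ H and equality of
indices would give L = H. -/
theorem adj_of_mem_overgroups {p : ℕ} (hp : p.Prime) {M L H : AddSubgroup V}
    (hL : L ∈ overgroups p M) (hH : H ∈ overgroups p M) (hne : L ≠ H) :
    Adj p L H ∧ L ⊓ H = M := by
  have key : L ⊓ H = M := by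
    rcases eq_or_eq_of_relIndex_prime hp (le_inf hL.1 hH.1) inf_le_left hL.2 with h | h
    · exact h
    · have h1 : L ≤ H := inf_eq_left.1 h
      exact absurd (eq_of_le_of_relIndex_eq' hL.1 h1 (by rw [hL.2, hH.2])
        (by rw [hL.2]; exact hp.ne_zero)) hne
  refine ⟨⟨?_, ?_⟩, key⟩
  · rw [← AddSubgroup.inf_relIndex_left, key, hL.2]
  · rw [← AddSubgroup.inf_relIndex_right, key, hH.2]

theorem adj_of_mem_undergroups {p : ℕ} (hp : p.Prime) {J L H : AddSubgroup V}
    (hL : L ∈ undergroups p J) (hH : H ∈ undergroups p J) (hne : L ≠ H) :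
    Adj p L H ∧ L ⊔ H = J := by
  have key : L ⊔ H = J := by
    rcases eq_or_eq_of_relIndex_prime hp le_sup_left (sup_le hL.1 hH.1) hL.2 with h | h
    · have h1 : H ≤ L := sup_eq_left.1 h
      exact absurd (eq_of_le_of_relIndex_eq h1 hL.1 (by rw [hL.2, hH.2])
        (by rw [hL.2]; exact hp.ne_zero)).symm hne
    · exact h
  refine ⟨⟨?_, ?_⟩, key⟩
  · rw [← AddSubgroup.relIndex_sup_right, key, hH.2]
  · rw [← AddSubgroup.relIndex_sup_left, key, hL.2]

theorem Adj.ne {p : ℕ} (hp : p.Prime) {L H : AddSubgroup V} (h : Adj p L H) : L ≠ H := by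
  rintro rfl
  have := h.1
  rw [AddSubgroup.relIndex_self] at this
  exact hp.one_lt.ne this

theorem Adj.inf_mem {p : ℕ} {L H : AddSubgroup V} (h : Adj p L H) :
    L ⊓ H ∈ undergroups p L ∧ L ∈ overgroups p (L ⊓ H) ∧ H ∈ overgroups p (L ⊓ H) := by
  have h1 : (L ⊓ H).relIndex L = p := by rw [AddSubgroup.inf_relIndex_left, h.1]
  have h2 : (L ⊓ H).relIndex H = p := by rw [AddSubgroup.inf_relIndex_right, h.2]
  exact ⟨⟨inf_le_left, h1⟩, ⟨inf_le_left, h1⟩, ⟨inf_le_right, h2⟩⟩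

theorem Adj.sup_mem {p : ℕ} {L H : AddSubgroup V} (h : Adj p L H) :
    L ⊔ H ∈ overgroups p L ∧ L ∈ undergroups p (L ⊔ H) ∧ H ∈ undergroups p (L ⊔ H) := by
  have h1 : L.relIndex (L ⊔ H) = p := by rw [AddSubgroup.relIndex_sup_left, h.2]
  have h2 : H.relIndex (L ⊔ H) = p := by rw [AddSubgroup.relIndex_sup_right, h.1]
  exact ⟨⟨le_sup_left, h1⟩, ⟨le_sup_left, h1⟩, ⟨le_sup_right, h2⟩⟩

/-- Neighbours H of L are grouped by M = L ∩ H; the fibre over M consists of the overgroups of M of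
index p other than L. -/
theorem ncard_adj_eq_under_mul {p m : ℕ} (hp : p.Prime) {L : AddSubgroup V}
    (hfin : {H | Adj p L H}.Finite) (hdown : (undergroups p L).Finite)
    (hm : ∀ M ∈ undergroups p L, (overgroups p M).ncard = m) :
    {H | Adj p L H}.ncard = (undergroups p L).ncard * (m - 1) := by
  refine ncard_eq_mul_of_fibers (fun H => L ⊓ H) hfin hdown (fun H hH => hH.inf_mem.1) ?_
  intro M hM
  have hL : L ∈ overgroups p M := hM
  rw [← hm M hM, ← Set.ncard_sdiff_singleton_of_mem hL]
  congr 1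
  ext H
  constructor
  · rintro ⟨h, rfl⟩
    exact ⟨h.inf_mem.2.2, fun h' => h.ne hp h'.symm⟩
  · rintro ⟨h, hne⟩
    exact adj_of_mem_overgroups hp hL h fun h' => hne h'.symm

/-- The dual count, with neighbours grouped by L + H. -/
theorem ncard_adj_eq_over_mul {p s : ℕ} (hp : p.Prime) {L : AddSubgroup V}
    (hfin : {H | Adj p L H}.Finite) (hup : (overgroups p L).Finite)
    (hs : ∀ J ∈ overgroups p L, (undergroups p J).ncard = s) :
    {H | Adj p L H}.ncard = (overgroups p L).ncard * (s - 1) := by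
  refine ncard_eq_mul_of_fibers (fun H => L ⊔ H) hfin hup (fun H hH => hH.sup_mem.1) ?_
  intro J hJ
  have hL : L ∈ undergroups p J := hJ
  rw [← hs J hJ, ← Set.ncard_sdiff_singleton_of_mem hL]
  congr 1
  ext H
  constructor
  · rintro ⟨h, rfl⟩
    exact ⟨h.sup_mem.2.2, fun h' => h.ne hp h'.symm⟩
  · rintro ⟨h, hne⟩
    exact adj_of_mem_undergroups hp hL h fun h' => hne h'.symm

theorem inf_eq_inf_or_sup_eq {p : ℕ} (hp : p.Prime) {L H K : AddSubgroup V} (h : Adj p L H)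
    (h' : Adj p H K) : L ⊓ H = H ⊓ K ∨ (L ⊓ H) ⊔ (H ⊓ K) = H := by
  by_cases hne : L ⊓ H = H ⊓ K
  · exact Or.inl hne
  · exact Or.inr (adj_of_mem_undergroups hp h.inf_mem.2.2 h'.inf_mem.2.1 hne).2

/-- Let H be a common neighbour. If L ∩ H = H ∩ K, this subgroup is L ∩ K, so H lies above L ∩ K;
otherwise these two subgroups generate H, so H lies below L + K. The p + 1 subgroups doing both are
counted twice, and L and K themselves are excluded, whence p + 3. -/
theorem ncard_common_adj_of_adj {p : ℕ} (hp : p.Prime) {L K : AddSubgroup V} (hLK : Adj p L K)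
    (hA : (overgroups p (L ⊓ K)).Finite) (hB : (undergroups p (L ⊔ K)).Finite) :
    {H | Adj p L H ∧ Adj p H K}.ncard + (p + 3) =
      (overgroups p (L ⊓ K)).ncard + (undergroups p (L ⊔ K)).ncard := by
  classical
  obtain ⟨-, hLM, hKM⟩ := hLK.inf_mem
  obtain ⟨-, hLJ, hKJ⟩ := hLK.sup_mem
  have hMJ : (L ⊓ K).relIndex (L ⊔ K) = p ^ 2 := by
    rw [← AddSubgroup.relIndex_mul_relIndex (L ⊓ K) L (L ⊔ K) inf_le_left le_sup_left, hLM.2,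
      hLJ.2, sq]
  have hinter : (overgroups p (L ⊓ K) ∩ undergroups p (L ⊔ K)).ncard = p + 1 := by
    have h1 := ncard_between hp (inf_le_left.trans le_sup_left) hMJ
    rw [if_pos] at h1
    · rw [← h1]
      congr 1
      ext P
      constructor
      · rintro ⟨h2, h3⟩
        exact ⟨h3, h2.1⟩
      · rintro ⟨h2, h3⟩
        exact ⟨⟨h3, (relIndex_between hp h3 h2.1 hMJ).2 h2.2⟩, h2⟩
    -- p kills (L + K)/L and (L + K)/K, hence also (L + K)/(L ∩ K).
    · intro v hv
      have e1 := nsmulLE_relIndex (L ⊔ K) L v hv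
      have e2 := nsmulLE_relIndex (L ⊔ K) K v hv
      rw [hLJ.2] at e1
      rw [hKJ.2] at e2
      exact ⟨e1, e2⟩
  have hset : {H | Adj p L H ∧ Adj p H K} =
      (overgroups p (L ⊓ K) ∪ undergroups p (L ⊔ K)) \ {L, K} := by
    ext H
    constructor
    · rintro ⟨h, h'⟩
      refine ⟨?_, ?_⟩
      · rcases inf_eq_inf_or_sup_eq hp h h' with he | he
        · left
          have h1 : L ⊓ H ≤ L ⊓ K := le_inf inf_le_left (he.le.trans inf_le_right)
          have h2 : L ⊓ H = L ⊓ K := eq_of_le_of_relIndex_eq h1 inf_le_left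
            (by rw [h.inf_mem.2.1.2, hLM.2]) (by rw [hLM.2]; exact hp.ne_zero)
          rw [← h2]
          exact h.inf_mem.2.2
        · right
          have h1 : H ≤ L ⊔ K := by
            rw [← he]
            exact sup_le_sup inf_le_left inf_le_right
          have h2 : L ⊔ H = L ⊔ K := eq_of_le_of_relIndex_eq' le_sup_left (sup_le le_sup_left h1)
            (by rw [hLJ.2, h.sup_mem.1.2]) (by rw [h.sup_mem.1.2]; exact hp.ne_zero)
          rw [← h2]
          exact h.sup_mem.2.2
      · rintro (rfl | rfl)
        · exact h.ne hp rfl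
        · exact h'.ne hp rfl
    · rintro ⟨h, hne⟩
      have hL : L ≠ H := fun e => hne (Or.inl e.symm)
      have hK : H ≠ K := fun e => hne (Or.inr e)
      rcases h with h | h
      · exact ⟨(adj_of_mem_overgroups hp hLM h hL).1, (adj_of_mem_overgroups hp h hKM hK).1⟩
      · exact ⟨(adj_of_mem_undergroups hp hLJ h hL).1, (adj_of_mem_undergroups hp h hKJ hK).1⟩
  have h1 := Set.ncard_union_add_ncard_inter _ _ hA hB
  rw [hinter] at h1
  have hsub : ({L, K} : Set (AddSubgroup V)) ⊆
      overgroups p (L ⊓ K) ∪ undergroups p (L ⊔ K) := by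
    rintro _ (rfl | rfl)
    · exact Or.inl hLM
    · exact Or.inl hKM
  have h2 := Set.ncard_sdiff_add_ncard_of_subset hsub (hA.union hB)
  rw [Set.ncard_pair (hLK.ne hp)] at h2
  rw [hset]
  omega

/-- P ∩ Q = L ∩ K gives [P + Q : P] = [Q : L ∩ K] = p. Hence L ∩ (P + Q) is P or P + Q, and the
latter would put Q inside L ∩ K. -/
theorem adj_sup_of_between {p : ℕ} (hp : p.Prime) {L K P Q : AddSubgroup V}
    (hK : (L ⊓ K).relIndex K = p ^ 2)
    (hP : P ∈ undergroups p L) (hMP : L ⊓ K ≤ P) (hQ : Q ∈ undergroups p K) (hMQ : L ⊓ K ≤ Q) :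
    Adj p L (P ⊔ Q) ∧ L ⊓ (P ⊔ Q) = P := by
  have hPQ : P ⊓ Q = L ⊓ K := le_antisymm (inf_le_inf hP.1 hQ.1) (le_inf hMP hMQ)
  have hQi : (L ⊓ K).relIndex Q = p := (relIndex_between hp hMQ hQ.1 hK).2 hQ.2
  have hPH : P.relIndex (P ⊔ Q) = p := by
    rw [AddSubgroup.relIndex_sup_left, ← AddSubgroup.inf_relIndex_right, hPQ, hQi]
  have key : L ⊓ (P ⊔ Q) = P := by
    rcases eq_or_eq_of_relIndex_prime hp (le_inf hP.1 le_sup_left) inf_le_right hPH with h | h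
    · exact h
    · exfalso
      have h1 : Q ≤ L := le_sup_right.trans (inf_eq_right.1 h)
      have h2 : (L ⊓ K).relIndex Q = 1 := AddSubgroup.relIndex_eq_one.2 (le_inf h1 hQ.1)
      exact hp.one_lt.ne' (hQi.symm.trans h2)
  refine ⟨⟨?_, ?_⟩, key⟩
  · rw [← AddSubgroup.inf_relIndex_left, key, hP.2]
  · rw [← AddSubgroup.inf_relIndex_right, key, hPH]

theorem relIndex_inf_of_adj_of_adj {p : ℕ} (hp : p.Prime) {L H K : AddSubgroup V} (h : Adj p L H)
    (h' : Adj p H K) (hne : L ⊓ H ≠ H ⊓ K) :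
    ((L ⊓ H) ⊓ (H ⊓ K)).relIndex L = p ^ 2 := by
  have h1 := (adj_of_mem_undergroups hp h.inf_mem.2.2 h'.inf_mem.2.1 hne).1.inf_mem.2.1
  rw [← AddSubgroup.relIndex_mul_relIndex _ _ _ h1.1 inf_le_left, h1.2, h.inf_mem.2.1.2, sq]

-- H ↦ (L ∩ H, H ∩ K) is a bijection onto the pairs (P, Q) with P between L ∩ K and L, Q between L ∩
-- K and K, both of index p; its inverse is (P, Q) ↦ P + Q. The two components always differ, since
-- otherwise L ∩ H ≤ L ∩ K and p² would divide p.
open Classical in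
theorem ncard_common_adj_of_relIndex_sq {p : ℕ} (hp : p.Prime) {L K : AddSubgroup V}
    (hL : K.relIndex L = p ^ 2) (hK : L.relIndex K = p ^ 2) :
    {H | Adj p L H ∧ Adj p H K}.ncard =
      (if NsmulLE p L K then p + 1 else 1) * (if NsmulLE p K L then p + 1 else 1) := by
  have hL' : (L ⊓ K).relIndex L = p ^ 2 := by rw [AddSubgroup.inf_relIndex_left, hL]
  have hK' : (L ⊓ K).relIndex K = p ^ 2 := by rw [AddSubgroup.inf_relIndex_right, hK]
  have e1 : NsmulLE p L K ↔ NsmulLE p L (L ⊓ K) :=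
    ⟨fun h v hv => ⟨L.nsmul_mem hv p, h v hv⟩, fun h v hv => (h v hv).2⟩
  have e2 : NsmulLE p K L ↔ NsmulLE p K (L ⊓ K) :=
    ⟨fun h v hv => ⟨h v hv, K.nsmul_mem hv p⟩, fun h v hv => (h v hv).1⟩
  rw [propext e1, propext e2, ← ncard_between hp inf_le_left hL', ← ncard_between hp inf_le_right hK',
    ← Set.ncard_prod]
  have hL0 : (L ⊓ K).relIndex L ≠ 0 := by rw [hL']; exact pow_ne_zero _ hp.ne_zero
  have hne : ∀ H, Adj p L H → Adj p H K → L ⊓ H ≠ H ⊓ K := by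
    intro H h h' he
    have h1 : L ⊓ H ≤ L ⊓ K := le_inf inf_le_left (he.le.trans inf_le_right)
    have h2 := AddSubgroup.relIndex_mul_relIndex _ _ _ h1 inf_le_left
    rw [h.inf_mem.2.1.2, hL'] at h2
    have h3 := Nat.le_of_dvd hp.pos ⟨_, by rw [mul_comm]; exact h2.symm⟩
    have := hp.two_le
    nlinarith
  refine Set.ncard_congr (fun H _ => (L ⊓ H, H ⊓ K)) ?_ ?_ ?_
  · rintro H ⟨h, h'⟩
    have h1 := relIndex_inf_of_adj_of_adj hp h h' (hne H h h')
    have h2 : (L ⊓ H) ⊓ (H ⊓ K) = L ⊓ K :=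
      eq_of_le_of_relIndex_eq (inf_le_inf inf_le_left inf_le_right) inf_le_left
        (by rw [h1, hL']) hL0
    exact ⟨⟨h.inf_mem.1, h2.ge.trans inf_le_left⟩,
      ⟨⟨inf_le_right, h'.inf_mem.2.2.2⟩, h2.ge.trans inf_le_right⟩⟩
  · rintro H H' ⟨h, h'⟩ ⟨g, g'⟩ he
    have he1 : L ⊓ H = L ⊓ H' := congrArg Prod.fst he
    have he2 : H ⊓ K = H' ⊓ K := congrArg Prod.snd he
    rw [← (inf_eq_inf_or_sup_eq hp h h').resolve_left (hne H h h'),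
      ← (inf_eq_inf_or_sup_eq hp g g').resolve_left (hne H' g g'), he1, he2]
  · rintro ⟨P, Q⟩ ⟨⟨hP, hMP⟩, ⟨hQ, hMQ⟩⟩
    have h1 := adj_sup_of_between hp hK' hP hMP hQ hMQ
    have h2 := adj_sup_of_between (L := K) (K := L) hp (by rwa [inf_comm]) hQ
      (by rwa [inf_comm]) hP (by rwa [inf_comm])
    rw [sup_comm] at h2
    refine ⟨P ⊔ Q, ⟨h1.1, h2.1.symm⟩, ?_⟩
    rw [h1.2, inf_comm, h2.2]

/-- If L ∩ H = H ∩ K, then L and K are overgroups of the same subgroup, so they are equal or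
adjacent. Otherwise N = L ∩ H ∩ K has index p² in both L and K, so [L : L ∩ K] and [K : L ∩ K] both
equal p² / [L ∩ K : N]. -/
theorem relIndex_of_adj_of_adj {p : ℕ} (hp : p.Prime) {L H K : AddSubgroup V} (h : Adj p L H)
    (h' : Adj p H K) : K = L ∨ Adj p L K ∨ (K.relIndex L = p ^ 2 ∧ L.relIndex K = p ^ 2) := by
  by_cases he : L ⊓ H = H ⊓ K
  · by_cases hKL : L = K
    · exact Or.inl hKL.symm
    · refine Or.inr (Or.inl (adj_of_mem_overgroups hp h.inf_mem.2.1 ?_ hKL).1)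
      rw [he]
      exact h'.inf_mem.2.2
  · have h1 := relIndex_inf_of_adj_of_adj hp h h' he
    have h2 := relIndex_inf_of_adj_of_adj hp h'.symm h.symm
      (by rw [inf_comm K H, inf_comm H L]; exact Ne.symm he)
    rw [inf_comm K H, inf_comm H L, inf_comm (H ⊓ K)] at h2
    set N := (L ⊓ H) ⊓ (H ⊓ K)
    have hN : N ≤ L ⊓ K := inf_le_inf inf_le_left inf_le_right
    have e1 := AddSubgroup.relIndex_mul_relIndex _ _ _ hN inf_le_left
    have e2 := AddSubgroup.relIndex_mul_relIndex _ _ _ hN inf_le_right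
    rw [AddSubgroup.inf_relIndex_left, h1] at e1
    rw [AddSubgroup.inf_relIndex_right, h2] at e2
    have hp2 : 0 < p ^ 2 := pow_pos hp.pos 2
    have h0 : 0 < N.relIndex (L ⊓ K) := Nat.pos_of_ne_zero fun h0 => by
      rw [h0, zero_mul] at e1; exact hp2.ne e1
    have heq : K.relIndex L = L.relIndex K := Nat.eq_of_mul_eq_mul_left h0 (e1.trans e2.symm)
    obtain ⟨k, hk, hk'⟩ := (Nat.dvd_prime_pow hp).1 ⟨_, by rw [mul_comm]; exact e1.symm⟩
    interval_cases k
    · left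
      rw [pow_zero] at hk'
      exact le_antisymm (AddSubgroup.relIndex_eq_one.1 (heq ▸ hk')) (AddSubgroup.relIndex_eq_one.1 hk')
    · rw [pow_one] at hk'
      exact Or.inr (Or.inl ⟨hk', heq ▸ hk'⟩)
    · exact Or.inr (Or.inr ⟨hk', heq ▸ hk'⟩)

/-- If pv ∈ L and qv ∈ K, then p²v and q²v lie in H, and p² and q² are coprime. In particular H is
determined by L and K. -/
theorem mem_iff_of_adj_of_adj {p q : ℕ} (hpq : p.Coprime q) {L H K : AddSubgroup V}
    (h : Adj p L H) (h' : Adj q H K) (v : V) : v ∈ H ↔ p • v ∈ L ∧ q • v ∈ K := by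
  constructor
  · intro hv
    refine ⟨?_, ?_⟩
    · have := nsmulLE_relIndex H L v hv
      rwa [h.2] at this
    · have := nsmulLE_relIndex H K v hv
      rwa [h'.1] at this
  · rintro ⟨h1, h2⟩
    have h3 := nsmulLE_relIndex L H _ h1
    have h4 := nsmulLE_relIndex K H _ h2
    rw [h.1, smul_smul] at h3
    rw [h'.2, smul_smul] at h4
    have hc : IsCoprime ((p * p : ℕ) : ℤ) ((q * q : ℕ) : ℤ) :=
      Nat.isCoprime_iff_coprime.2 ((hpq.mul_left hpq).mul_right (hpq.mul_left hpq))
    obtain ⟨a, b, hab⟩ := hc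
    have h5 : v = a • ((p * p) • v) + b • ((q * q) • v) := by
      rw [← natCast_zsmul v (p * p), ← natCast_zsmul v (q * q), smul_smul, smul_smul, ← add_smul,
        hab, one_smul]
    rw [h5]
    exact H.add_mem (H.zsmul_mem h3 a) (H.zsmul_mem h4 b)

/-- The criterion above gives L ∩ K ≤ H, so L ∩ K is the intersection of L ∩ H and H ∩ K. These have
distinct prime indices p and q in H, so they generate H, and [L ∩ H : L ∩ K] = q. -/
theorem relIndex_of_adj_of_adj_of_ne {p q : ℕ} (hp : p.Prime) (hq : q.Prime) (hpq : p ≠ q)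
    {L H K : AddSubgroup V} (h : Adj p L H) (h' : Adj q H K) : K.relIndex L = p * q := by
  have hc : p.Coprime q := (Nat.coprime_primes hp hq).2 hpq
  have hle : L ⊓ K ≤ H := fun v hv =>
    (mem_iff_of_adj_of_adj hc h h' v).2 ⟨L.nsmul_mem hv.1 p, K.nsmul_mem hv.2 q⟩
  have hinf : (L ⊓ H) ⊓ (H ⊓ K) = L ⊓ K :=
    le_antisymm (inf_le_inf inf_le_left inf_le_right)
      (le_inf (le_inf inf_le_left hle) (le_inf hle inf_le_right))
  have hP := h.inf_mem.2.2
  have hQ := h'.inf_mem.2.1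
  have hsup : (L ⊓ H) ⊔ (H ⊓ K) = H := by
    rcases eq_or_eq_of_relIndex_prime hp le_sup_left (sup_le hP.1 hQ.1) hP.2 with e | e
    · have h1 := AddSubgroup.relIndex_mul_relIndex _ _ _ (sup_eq_left.1 e) hP.1
      rw [hP.2, hQ.2] at h1
      exact absurd ((Nat.prime_dvd_prime_iff_eq hp hq).1 ⟨_, by rw [mul_comm]; exact h1.symm⟩) hpq
    · exact e
  have h1 : (L ⊓ K).relIndex (L ⊓ H) = q := by
    rw [← hinf, AddSubgroup.inf_relIndex_left, ← AddSubgroup.relIndex_sup_right, hsup, hQ.2]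
  rw [← AddSubgroup.inf_relIndex_left,
    ← AddSubgroup.relIndex_mul_relIndex _ (L ⊓ H) _ (le_inf inf_le_left hle) inf_le_left, h1,
    h.inf_mem.1.2, mul_comm]

theorem ncard_common_adj_of_ne {p q : ℕ} (hp : p.Prime) (hq : q.Prime) (hpq : p ≠ q)
    {L K : AddSubgroup V} (h : ∃ H, Adj p L H ∧ Adj q H K) :
    {H | Adj p L H ∧ Adj q H K}.ncard = 1 := by
  have hc : p.Coprime q := (Nat.coprime_primes hp hq).2 hpq
  obtain ⟨H, h, h'⟩ := h
  rw [Set.ncard_eq_one]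
  refine ⟨H, Set.eq_singleton_iff_unique_mem.2 ⟨⟨h, h'⟩, ?_⟩⟩
  rintro H' ⟨g, g'⟩
  ext v
  rw [mem_iff_of_adj_of_adj hc g g', mem_iff_of_adj_of_adj hc h h']

/-- L + K lies between L and H, of prime index. If it were L, then K ≤ L, so p divides q; hence p =
q and K = L, the excluded case. -/
theorem relIndex_of_mem_overgroups_of_mem_undergroups {p q : ℕ} (hp : p.Prime) (hq : q.Prime)
    {L H K : AddSubgroup V} (hne : ¬ (p = q ∧ K = L)) (h : H ∈ overgroups p L)
    (h' : K ∈ undergroups q H) : H = L ⊔ K ∧ K.relIndex L = q ∧ L.relIndex K = p := by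
  rcases eq_or_eq_of_relIndex_prime hp le_sup_left (sup_le h.1 h'.1) h.2 with e | e
  · have hKL : K ≤ L := sup_eq_left.1 e
    have h1 := AddSubgroup.relIndex_mul_relIndex _ _ _ hKL h.1
    rw [h.2, h'.2] at h1
    have hpq : p = q := (Nat.prime_dvd_prime_iff_eq hp hq).1 ⟨_, by rw [mul_comm]; exact h1.symm⟩
    refine absurd ⟨hpq, le_antisymm hKL (AddSubgroup.relIndex_eq_one.1 ?_)⟩ hne
    rw [← hpq] at h1
    exact Nat.eq_of_mul_eq_mul_right hp.pos (h1.trans (one_mul p).symm)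
  · refine ⟨e.symm, ?_, ?_⟩
    · rw [← AddSubgroup.relIndex_sup_right, e, h'.2]
    · rw [← AddSubgroup.relIndex_sup_left, e, h.2]

open Classical in
theorem ncard_overgroups_undergroups {p q : ℕ} (hp : p.Prime) (hq : q.Prime)
    {L K : AddSubgroup V} (hne : ¬ (p = q ∧ K = L)) :
    {H | H ∈ overgroups p L ∧ K ∈ undergroups q H}.ncard =
      if K.relIndex L = q ∧ L.relIndex K = p then 1 else 0 := by
  split_ifs with h
  · rw [Set.ncard_eq_one]
    refine ⟨L ⊔ K, Set.eq_singleton_iff_unique_mem.2 ⟨⟨⟨le_sup_left, ?_⟩, le_sup_right, ?_⟩, ?_⟩⟩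
    · rw [AddSubgroup.relIndex_sup_left, h.2]
    · rw [AddSubgroup.relIndex_sup_right, h.1]
    · rintro H ⟨h1, h2⟩
      exact (relIndex_of_mem_overgroups_of_mem_undergroups hp hq hne h1 h2).1
  · convert Set.ncard_empty (AddSubgroup V)
    ext H
    refine ⟨fun ⟨h1, h2⟩ => h ?_, fun h => h.elim⟩
    exact (relIndex_of_mem_overgroups_of_mem_undergroups hp hq hne h1 h2).2

end Counting

/-! ### Numbers of neighbours of the standard lattice -/

theorem HasKernel.congr {n : ℕ} {O : Module.End ℂ (autFun n)}
    {κ κ' : AddSubgroup (Fin n → ℚ) → ℂ} (h : HasKernel O κ) (hκ : ∀ K, κ K = κ' K) :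
    HasKernel O κ' := by
  rwa [← funext hκ]

theorem overgroups_act {n : ℕ} (p : ℕ) (x : GL (Fin n) ℚ) (L : AddSubgroup (Fin n → ℚ)) :
    (overgroups p (act x L)).ncard = (overgroups p L).ncard := by
  rw [← Set.ncard_image_of_injective (overgroups p L) (act_injective x)]
  congr 1
  ext H
  constructor
  · rintro ⟨h1, h2⟩
    refine ⟨act x⁻¹ H, ⟨?_, ?_⟩, act_act_inv _ _⟩
    · rwa [← act_le_act (x := x), act_act_inv]
    · rwa [← relIndex_act x, act_act_inv]
  · rintro ⟨H, ⟨h1, h2⟩, rfl⟩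
    exact ⟨act_le_act.2 h1, by rwa [relIndex_act]⟩

theorem undergroups_act {n : ℕ} (p : ℕ) (x : GL (Fin n) ℚ) (L : AddSubgroup (Fin n → ℚ)) :
    (undergroups p (act x L)).ncard = (undergroups p L).ncard := by
  rw [← Set.ncard_image_of_injective (undergroups p L) (act_injective x)]
  congr 1
  ext H
  constructor
  · rintro ⟨h1, h2⟩
    refine ⟨act x⁻¹ H, ⟨?_, ?_⟩, act_act_inv _ _⟩
    · rwa [← act_le_act (x := x), act_act_inv]
    · rwa [← relIndex_act x, act_act_inv]
  · rintro ⟨H, ⟨h1, h2⟩, rfl⟩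
    exact ⟨act_le_act.2 h1, by rwa [relIndex_act]⟩

/-- An overgroup of index p lies in p⁻¹ℤ^n, so these are the subgroups of order p in p⁻¹ℤ^n / ℤ^n, a
group of order p^n killed by p. -/
theorem ncard_overgroups_stdLat {n p : ℕ} (hp : p.Prime) :
    (overgroups p (stdLat n)).ncard * (p - 1) = p ^ n - 1 := by
  have h1 : ∀ i : Fin n, ∀ z : ℤ, (∃ w : ℤ, (w : ℚ) * 1 = z * (1 / (p : ℚ))) ↔ (p : ℤ) ∣ z :=
    fun _ z => by simpa using exists_mul_one_iff hp.ne_zero (Nat.coprime_one_left p) z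
  have hidx : (stdLat n).relIndex (box fun _ => 1 / (p : ℚ)) = p ^ n := by
    rw [stdLat, relIndex_box h1]; simp
  have hns : NsmulLE p (box fun _ : Fin n => 1 / (p : ℚ)) (stdLat n) :=
    (nsmulLE_box h1 p).2 fun _ => dvd_rfl
  have hp0 : (p : ℚ) ≠ 0 := by exact_mod_cast hp.ne_zero
  have hle : ∀ H : AddSubgroup (Fin n → ℚ), NsmulLE p H (stdLat n) →
      H ≤ box fun _ => 1 / (p : ℚ) := by
    intro H hH v hv
    rw [mem_box]
    intro i
    obtain ⟨z, hz⟩ := mem_stdLat.1 (hH v hv) i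
    refine ⟨z, ?_⟩
    rw [hz, Pi.smul_apply, nsmul_eq_mul]
    field_simp
  rw [← hidx, ← ncard_between_of_nsmulLE hp ?_ (by rw [hidx]; exact pow_ne_zero _ hp.ne_zero) hns]
  · congr 2
    ext H
    constructor
    · rintro ⟨a, b⟩
      refine ⟨a, hle H ?_, b⟩
      rw [← b]
      exact nsmulLE_relIndex H _
    · rintro ⟨a, -, b⟩
      exact ⟨a, b⟩
  · exact hle _ fun v hv => (stdLat n).nsmul_mem hv p

/-- The conditions ignore their second argument, so the multiplier r is a dummy. -/
theorem overgroups_iff {n p : ℕ} {L H : AddSubgroup (Fin n → ℚ)} (r : ℕ) :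
    H ∈ overgroups p L ↔ IndexRel r (fun i _ => i = 1) (fun i _ => i = p) L H :=
  and_congr_left fun _ => AddSubgroup.relIndex_eq_one.symm

theorem undergroups_iff {n p : ℕ} {L H : AddSubgroup (Fin n → ℚ)} (r : ℕ) :
    H ∈ undergroups p L ↔ IndexRel r (fun i _ => i = p) (fun i _ => i = 1) L H :=
  and_comm.trans (and_congr_right fun _ => AddSubgroup.relIndex_eq_one.symm)

section

variable {n : ℕ} {p : ℕ+}

theorem mem_overgroups_stdLat_iff (hn : 2 ≤ n) (hp : p.Prime) (H : AddSubgroup (Fin n → ℚ)) :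
    H ∈ overgroups p (stdLat n) ↔ H ∈ orbitLat (unitBlocks n 1 0 p 1) := by
  rw [overgroups_iff 1]
  exact indexRel_iff_mem_orbitLat (by omega) detects_one
    (detects_squarefree hn (Nat.Prime.prime hp).squarefree) H

theorem mem_undergroups_stdLat_iff (hn : 2 ≤ n) (hp : p.Prime) (H : AddSubgroup (Fin n → ℚ)) :
    H ∈ undergroups p (stdLat n) ↔ H ∈ orbitLat (unitBlocks n 0 1 1 p) := by
  rw [undergroups_iff 1]
  exact indexRel_iff_mem_orbitLat (by omega)
    (detects_squarefree hn (Nat.Prime.prime hp).squarefree) detects_one H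

theorem adj_stdLat_iff (hn : 2 ≤ n) (hp : p.Prime) (H : AddSubgroup (Fin n → ℚ)) :
    Adj p (stdLat n) H ↔ H ∈ orbitLat (unitBlocks n 1 1 p p) :=
  indexRel_iff_mem_orbitLat (p := 1) (Φ := fun i _ => i = p) (Ψ := fun i _ => i = p) (by omega)
    (detects_squarefree hn (Nat.Prime.prime hp).squarefree)
    (detects_squarefree hn (Nat.Prime.prime hp).squarefree) H

theorem overgroups_finite (hn : 2 ≤ n) (hp : p.Prime) (x : GL (Fin n) ℚ) :
    (overgroups p (act x (stdLat n))).Finite := by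
  refine Set.finite_of_ncard_ne_zero ?_
  rw [overgroups_act]
  intro h
  have h1 := ncard_overgroups_stdLat (n := n) hp
  rw [h, zero_mul] at h1
  have := Nat.one_lt_pow (by omega : n ≠ 0) (Nat.Prime.one_lt hp)
  omega

theorem ncard_undergroups_stdLat_pos (hn : 2 ≤ n) (hp : p.Prime) :
    0 < (undergroups p (stdLat n)).ncard := by
  have h : undergroups (p : ℕ) (stdLat n) = orbitLat (unitBlocks n 0 1 1 p) :=
    Set.ext (mem_undergroups_stdLat_iff hn hp)
  rw [h, Set.ncard_pos (finite_orbitLat _)]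
  exact ⟨_, 1, (lam n).one_mem, rfl⟩

theorem undergroups_finite (hn : 2 ≤ n) (hp : p.Prime) (x : GL (Fin n) ℚ) :
    (undergroups p (act x (stdLat n))).Finite := by
  refine Set.finite_of_ncard_ne_zero ?_
  rw [undergroups_act]
  exact (ncard_undergroups_stdLat_pos hn hp).ne'

theorem ncard_adj_stdLat (hn : 2 ≤ n) (hp : p.Prime) :
    {H | Adj p (stdLat n) H}.ncard =
      (undergroups p (stdLat n)).ncard * ((overgroups p (stdLat n)).ncard - 1) := by
  have hfin : {H | Adj p (stdLat n) H}.Finite := (finite_orbitLat _).subset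
    fun H hH => (adj_stdLat_iff hn hp H).1 hH
  refine ncard_adj_eq_under_mul hp hfin (by simpa using undergroups_finite hn hp (1 : GL (Fin n) ℚ)) ?_
  intro M hM
  obtain ⟨γ, -, rfl⟩ := (mem_undergroups_stdLat_iff hn hp M).1 hM
  exact overgroups_act _ _ _

/-- Counting the neighbours of ℤ^n by intersections and by sums gives s(m - 1) = m(s - 1), hence s =
m. This takes the place of lattice duality. -/
theorem ncard_undergroups_eq (hn : 2 ≤ n) (hp : p.Prime) :
    (undergroups p (stdLat n)).ncard = (overgroups p (stdLat n)).ncard := by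
  have hfin : {H | Adj p (stdLat n) H}.Finite := (finite_orbitLat _).subset
    fun H hH => (adj_stdLat_iff hn hp H).1 hH
  have hup : (overgroups p (stdLat n)).Finite := by
    simpa using overgroups_finite hn hp (1 : GL (Fin n) ℚ)
  have h1 := ncard_adj_stdLat hn hp
  rw [ncard_adj_eq_over_mul (s := (undergroups p (stdLat n)).ncard) hp hfin hup] at h1
  · have h2 := ncard_undergroups_stdLat_pos hn hp
    have h3 : 0 < (overgroups p (stdLat n)).ncard := (Set.ncard_pos hup).2
      ⟨_, (mem_overgroups_stdLat_iff hn hp _).2 ⟨1, (lam n).one_mem, rfl⟩⟩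
    generalize (undergroups p (stdLat n)).ncard = s at *
    generalize (overgroups p (stdLat n)).ncard = m at *
    obtain ⟨a, rfl⟩ := Nat.exists_eq_succ_of_ne_zero h2.ne'
    obtain ⟨b, rfl⟩ := Nat.exists_eq_succ_of_ne_zero h3.ne'
    simp only [Nat.succ_eq_add_one, Nat.add_sub_cancel] at h1 ⊢
    linarith
  · intro J hJ
    obtain ⟨γ, -, rfl⟩ := (mem_overgroups_stdLat_iff hn hp J).1 hJ
    exact undergroups_act _ _ _

theorem cast_ncard_overgroups (hp : p.Prime) :
    ((overgroups p (stdLat n)).ncard : ℂ) = (((p : ℕ) : ℂ) ^ n - 1) / (((p : ℕ) : ℂ) - 1) := by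
  have h1 := ncard_overgroups_stdLat (n := n) hp
  have hp1 : 1 < (p : ℕ) := Nat.Prime.one_lt hp
  have hne : ((p : ℕ) : ℂ) - 1 ≠ 0 := by
    rw [sub_ne_zero]; exact_mod_cast hp1.ne'
  rw [eq_div_iff hne]
  have h2 := congrArg (Nat.cast (R := ℂ)) h1
  rw [Nat.cast_mul, Nat.cast_sub hp1.le, Nat.cast_sub (Nat.one_le_pow _ _ p.pos)] at h2
  simpa using h2

end

/-! ### Comparison of kernels and the product formulas -/

theorem T_comp_over_under {n : ℕ} (hn : 2 ≤ n) {p q : ℕ+} (hp : p.Prime) (hq : q.Prime) :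
    T n 1 0 1 p p ∘ₗ T n 0 1 1 1 q = T n 1 1 1 p (p * q) +
      (if p = q then (((p : ℕ) : ℂ) ^ n - 1) / (((p : ℕ) : ℂ) - 1) else 0) • LinearMap.id := by
  classical
  have e1 : T n 1 0 1 p p = hecke (unitBlocks n 1 0 p 1) := by
    rw [← T_eq_hecke, mul_one]
  have e2 : T n 0 1 1 1 q = hecke (unitBlocks n 0 1 1 q) := by
    rw [← T_eq_hecke, one_mul]
  have hsp : Detects n 1 p 1 fun i _ => i = p :=
    detects_squarefree hn (Nat.Prime.prime hp).squarefree
  have hsq : Detects n 1 q 1 fun i _ => i = q :=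
    detects_squarefree hn (Nat.Prime.prime hq).squarefree
  rw [e1, e2, T_eq_hecke]
  refine ((hasKernel_hecke_comp_hecke (isInvariant_indexRel 1 _ _)
    (indexRel_iff_mem_orbitLat (by omega) detects_one hsp)
    (indexRel_iff_mem_orbitLat (by omega) hsq detects_one)).congr fun K => ?_).eq
    ((hasKernel_hecke (indexRel_iff_mem_orbitLat (by omega) hsq hsp)).add (hasKernel_id.smul _))
  simp only [← overgroups_iff, ← undergroups_iff]
  -- The only case in which H is not forced to be ℤ^n + K; it produces the scalar term.
  by_cases h : p = q ∧ K = stdLat n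
  · obtain ⟨rfl, rfl⟩ := h
    have h1 : {H | H ∈ overgroups p (stdLat n) ∧ stdLat n ∈ undergroups p H} =
        overgroups p (stdLat n) := Set.ext fun H => and_self_iff
    rw [h1, if_pos rfl, if_pos rfl, if_neg, cast_ncard_overgroups hp]
    · ring
    · rintro ⟨h2, -⟩
      rw [AddSubgroup.relIndex_self] at h2
      exact (Nat.Prime.one_lt hp).ne h2
  · rw [ncard_overgroups_undergroups hp hq (fun h' => h ⟨PNat.eq h'.1, h'.2⟩)]
    have h0 : (if p = q then (((p : ℕ) : ℂ) ^ n - 1) / (((p : ℕ) : ℂ) - 1) else 0) *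
        (if K = stdLat n then (1 : ℂ) else 0) = 0 := by
      split_ifs with a b
      · exact absurd ⟨a, b⟩ h
      · simp
      · simp
      · simp
    rw [h0, add_zero]
    push_cast
    exact if_congr Iff.rfl rfl rfl

theorem rmul_unitBlocks {n k l : ℕ} {b c : ℕ+} (hkl : k + l ≤ n) (v : Fin n → ℚ) (i : Fin n) :
    rmul (unitBlocks n k l b c) v i = v i * (topVec n l c i / botVec n k b i) := by
  have h1 : ∀ w : Fin n → ℚ, rmul (diagGL (blocks n k l 1 b (b * c))) w i =
      w i * ((blocks n k l 1 b (b * c) i : ℕ) : ℚ) := by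
    intro w
    change (w ᵥ* Matrix.diagonal fun i => ((blocks n k l 1 b (b * c) i : ℕ) : ℚ)) i = _
    rw [vecMul_diagonal]
  have hb : ((b : ℕ) : ℚ) ≠ 0 := Nat.cast_ne_zero.2 b.ne_zero
  rw [unitBlocks, rmul_mul, h1, rmul_scalar]
  simp only [Units.val_inv_eq_inv_val, Units.val_mk0, blocks, topVec, botVec, Pi.smul_apply,
    smul_eq_mul]
  split_ifs <;> first | omega | (push_cast; field_simp)

/-- Both sides are the action of diag(1/(pq), 1, …, 1, pq). The factorisation supplies the
intermediate lattice when p ≠ q. -/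
theorem act_unitBlocks_mul {n : ℕ} (hn : 2 ≤ n) (p q : ℕ+) (H : AddSubgroup (Fin n → ℚ)) :
    act (unitBlocks n 1 1 (p * q) (p * q)) H =
      act (unitBlocks n 1 1 q q * unitBlocks n 1 1 p p) H := by
  have h : ∀ v, rmul (unitBlocks n 1 1 (p * q) (p * q)) v =
      rmul (unitBlocks n 1 1 q q * unitBlocks n 1 1 p p) v := by
    intro v
    ext i
    rw [rmul_mul, rmul_unitBlocks hn, rmul_unitBlocks hn, rmul_unitBlocks hn, mul_assoc]
    congr 1
    have hp : ((p : ℕ) : ℚ) ≠ 0 := Nat.cast_ne_zero.2 p.ne_zero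
    have hq : ((q : ℕ) : ℚ) ≠ 0 := Nat.cast_ne_zero.2 q.ne_zero
    simp only [topVec, botVec]
    split_ifs <;> push_cast <;> field_simp
  ext v
  simp only [mem_act, h]

theorem T_comp_of_ne {n : ℕ} (hn : 2 ≤ n) {p q : ℕ+} (hp : p.Prime) (hq : q.Prime)
    (hpq : p ≠ q) :
    T n 1 1 1 p (p ^ 2) ∘ₗ T n 1 1 1 q (q ^ 2) = T n 1 1 1 (p * q) ((p * q) ^ 2) := by
  classical
  have hpq' : (p : ℕ) ≠ q := fun h => hpq (PNat.eq h)
  have hsp : Detects n 1 p 1 fun i _ => i = p :=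
    detects_squarefree hn (Nat.Prime.prime hp).squarefree
  have hsq : Detects n 1 q 1 fun i _ => i = q :=
    detects_squarefree hn (Nat.Prime.prime hq).squarefree
  have hspq : Detects n 1 (p * q : ℕ+) 1 fun i _ => i = (p * q : ℕ+) := by
    refine detects_squarefree hn ?_
    rw [PNat.mul_coe, Nat.squarefree_mul ((Nat.coprime_primes hp hq).2 hpq')]
    exact ⟨(Nat.Prime.prime hp).squarefree, (Nat.Prime.prime hq).squarefree⟩
  rw [sq, sq, sq, T_eq_hecke, T_eq_hecke, T_eq_hecke]
  refine ((hasKernel_hecke_comp_hecke (isInvariant_indexRel 1 _ _)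
    (indexRel_iff_mem_orbitLat (by omega) hsp hsp)
    (indexRel_iff_mem_orbitLat (by omega) hsq hsq)).congr fun K => ?_).eq
    (hasKernel_hecke (indexRel_iff_mem_orbitLat (by omega) hspq hspq))
  change ({H | Adj p (stdLat n) H ∧ Adj q H K}.ncard : ℂ) = _
  have hiff : IndexRel 1 (fun i _ => i = (p * q : ℕ+)) (fun i _ => i = (p * q : ℕ+)) (stdLat n) K ↔
      ∃ H, Adj p (stdLat n) H ∧ Adj q H K := by
    constructor
    · intro h
      obtain ⟨γ, hγ, rfl⟩ := (indexRel_iff_mem_orbitLat (by omega) hspq hspq K).1 h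
      refine ⟨act (unitBlocks n 1 1 p p * γ) (stdLat n), (adj_stdLat_iff hn hp _).2 ⟨γ, hγ, rfl⟩, ?_⟩
      rw [act_mul (unitBlocks n 1 1 (p * q) (p * q)), act_unitBlocks_mul hn, ← act_mul, mul_assoc,
        act_mul (unitBlocks n 1 1 q q)]
      change IndexRel 1 (fun i _ => i = (q : ℕ)) (fun i _ => i = (q : ℕ)) _ _
      rw [isInvariant_indexRel]
      exact (adj_stdLat_iff hn hq _).2 ⟨1, (lam n).one_mem, by rw [mul_one]⟩
    · rintro ⟨H, h, h'⟩
      refine ⟨?_, ?_⟩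
      · rw [relIndex_of_adj_of_adj_of_ne hp hq hpq' h h', PNat.mul_coe]
      · rw [relIndex_of_adj_of_adj_of_ne hq hp hpq'.symm h'.symm h.symm, PNat.mul_coe, mul_comm]
  split_ifs with h
  · rw [ncard_common_adj_of_ne hp hq hpq' (hiff.1 h), Nat.cast_one]
  · have h1 : {H | Adj p (stdLat n) H ∧ Adj q H K} = ∅ :=
      Set.eq_empty_of_forall_notMem fun H hH => h (hiff.2 ⟨H, hH⟩)
    rw [h1, Set.ncard_empty, Nat.cast_zero]

theorem cast_ncard_common_adj {n : ℕ} (hn : 2 ≤ n) {p : ℕ+} (hp : p.Prime)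
    {K : AddSubgroup (Fin n → ℚ)} (h : Adj p (stdLat n) K) :
    ({H | Adj p (stdLat n) H ∧ Adj p H K}.ncard : ℂ) =
      (2 * ((p : ℕ) : ℂ) ^ n - ((p : ℕ) : ℂ) ^ 2 - 2 * ((p : ℕ) : ℂ) + 1) /
        (((p : ℕ) : ℂ) - 1) := by
  obtain ⟨γ, -, h1⟩ := (mem_undergroups_stdLat_iff hn hp _).1 h.inf_mem.1
  obtain ⟨γ', -, h2⟩ := (mem_overgroups_stdLat_iff hn hp _).1 h.sup_mem.1
  have h3 := ncard_common_adj_of_adj hp h (by rw [h1]; exact overgroups_finite hn hp _)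
    (by rw [h2]; exact undergroups_finite hn hp _)
  rw [h1, h2, overgroups_act, undergroups_act, ncard_undergroups_eq hn hp] at h3
  have h4 := congrArg (Nat.cast (R := ℂ)) h3
  have hne : ((p : ℕ) : ℂ) - 1 ≠ 0 := by
    rw [sub_ne_zero]; exact_mod_cast (Nat.Prime.one_lt hp).ne'
  rw [Nat.cast_add, Nat.cast_add, Nat.cast_add, cast_ncard_overgroups hp, ← eq_sub_iff_add_eq] at h4
  rw [h4]
  field_simp
  push_cast
  ring

theorem cast_ncard_adj {n : ℕ} (hn : 2 ≤ n) {p : ℕ+} (hp : p.Prime) :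
    ({H | Adj p (stdLat n) H}.ncard : ℂ) =
      ((p : ℕ) : ℂ) * ((((p : ℕ) : ℂ) ^ (n - 1) - 1) * (((p : ℕ) : ℂ) ^ n - 1)) /
        (((p : ℕ) : ℂ) - 1) ^ 2 := by
  have hne : ((p : ℕ) : ℂ) - 1 ≠ 0 := by
    rw [sub_ne_zero]; exact_mod_cast (Nat.Prime.one_lt hp).ne'
  have hpos : 1 ≤ (overgroups p (stdLat n)).ncard := by
    rw [← ncard_undergroups_eq hn hp]
    exact ncard_undergroups_stdLat_pos hn hp
  rw [ncard_adj_stdLat hn hp, ncard_undergroups_eq hn hp, Nat.cast_mul, Nat.cast_sub hpos,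
    cast_ncard_overgroups hp]
  obtain ⟨m, rfl⟩ := Nat.exists_eq_add_of_le' (one_le_two.trans hn)
  rw [Nat.add_sub_cancel]
  field_simp
  push_cast
  ring

theorem T_comp_self {n : ℕ} (hn : 4 ≤ n) {p : ℕ+} (hp : p.Prime) :
    T n 1 1 1 p (p ^ 2) ∘ₗ T n 1 1 1 p (p ^ 2) =
      T n 1 1 1 (p * p) ((p * p) ^ 2) +
        (((2 * ((p : ℕ) : ℂ) ^ n - ((p : ℕ) : ℂ) ^ 2 - 2 * ((p : ℕ) : ℂ) + 1) /
              (((p : ℕ) : ℂ) - 1)) • T n 1 1 1 p (p ^ 2) +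
          (((p : ℕ) : ℂ) * ((((p : ℕ) : ℂ) ^ (n - 1) - 1) * (((p : ℕ) : ℂ) ^ n - 1)) /
              (((p : ℕ) : ℂ) - 1) ^ 2) • LinearMap.id +
          (((p : ℕ) : ℂ) + 1) • T n 1 2 1 (p ^ 2) (p ^ 3) +
          (((p : ℕ) : ℂ) + 1) • T n 2 1 1 p (p ^ 3) +
          (((p : ℕ) : ℂ) + 1) ^ 2 • T n 2 2 1 p (p ^ 2)) := by
  classical
  have hn2 : 2 ≤ n := by omega
  have hs : Detects n 1 p p fun i _ => i = p :=
    detects_squarefree hn2 (Nat.Prime.prime hp).squarefree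
  have he : Detects n 2 p p fun i P => i = (p : ℕ) ^ 2 ∧ P := detects_elementary hn2 hp
  have hc : Detects n 1 (p ^ 2 : ℕ+) p fun i P => i = (p : ℕ) ^ 2 ∧ ¬ P := by
    rw [PNat.pow_coe]
    exact detects_cyclic hn2 hp
  have e1 : T n 1 1 1 p (p ^ 2) = hecke (unitBlocks n 1 1 p p) := by rw [← T_eq_hecke, sq]
  have e2 : T n 1 1 1 (p * p) ((p * p) ^ 2) = hecke (unitBlocks n 1 1 (p ^ 2) (p ^ 2)) := by
    rw [← T_eq_hecke, ← sq, ← sq]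
  have e3 : T n 1 2 1 (p ^ 2) (p ^ 3) = hecke (unitBlocks n 1 2 (p ^ 2) p) := by
    rw [← T_eq_hecke, ← pow_succ]
  have e4 : T n 2 1 1 p (p ^ 3) = hecke (unitBlocks n 2 1 p (p ^ 2)) := by
    rw [← T_eq_hecke, ← pow_succ']
  have e5 : T n 2 2 1 p (p ^ 2) = hecke (unitBlocks n 2 2 p p) := by rw [← T_eq_hecke, sq]
  rw [e1, e2, e3, e4, e5]
  refine ((hasKernel_hecke_comp_hecke (isInvariant_indexRel (p : ℕ) _ _)
    (indexRel_iff_mem_orbitLat (by omega) hs hs)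
    (indexRel_iff_mem_orbitLat (by omega) hs hs)).congr fun K => ?_).eq
    ((hasKernel_hecke (indexRel_iff_mem_orbitLat (by omega) hc hc)).add
      ((((((hasKernel_hecke (indexRel_iff_mem_orbitLat (by omega) hs hs)).smul _).add
        (hasKernel_id.smul _)).add
        ((hasKernel_hecke (indexRel_iff_mem_orbitLat (by omega) he hc)).smul _)).add
        ((hasKernel_hecke (indexRel_iff_mem_orbitLat (by omega) hc he)).smul _)).add
        ((hasKernel_hecke (indexRel_iff_mem_orbitLat (by omega) he he)).smul _)))
  change ({H | Adj p (stdLat n) H ∧ Adj p H K}.ncard : ℂ) = _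
  have hp1 := Nat.Prime.one_lt hp
  have hpp : (p : ℕ) ≠ (p : ℕ) ^ 2 := by nlinarith
  have hp2 : (1 : ℕ) ≠ (p : ℕ) ^ 2 := by nlinarith
  have hp1' : p ≠ 1 := fun h => by simp [h] at hp1
  by_cases h0 : K = stdLat n
  · subst h0
    have h1 : {H | Adj p (stdLat n) H ∧ Adj p H (stdLat n)} = {H | Adj p (stdLat n) H} :=
      Set.ext fun H => ⟨fun h => h.1, fun h => ⟨h, h.symm⟩⟩
    rw [h1, cast_ncard_adj hn2 hp]
    simp [IndexRel, hp2, hp1.ne]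
  by_cases h1 : Adj p (stdLat n) K
  · rw [cast_ncard_common_adj hn2 hp h1]
    simp [IndexRel, h1.1, h1.2, hpp, h0]
  by_cases h2 : K.relIndex (stdLat n) = (p : ℕ) ^ 2 ∧ (stdLat n).relIndex K = (p : ℕ) ^ 2
  · rw [ncard_common_adj_of_relIndex_sq hp h2.1 h2.2]
    -- Each quotient of order p² is elementary or cyclic; the four combinations match the four
    -- operators with both indices p².
    by_cases ha : NsmulLE p (stdLat n) K <;> by_cases hb : NsmulLE p K (stdLat n) <;>
      simp [IndexRel, h2.1, h2.2, ha, hb, hp1', h0, sq]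
  · have h3 : {H | Adj p (stdLat n) H ∧ Adj p H K} = ∅ := by
      ext H
      refine ⟨fun ⟨a, b⟩ => ?_, fun h => h.elim⟩
      rcases relIndex_of_adj_of_adj hp a b with h | h | h
      · exact h0 h
      · exact h1 h
      · exact h2 h
    have g0 : ¬ IndexRel (p : ℕ) (fun i _ => i = p) (fun i _ => i = p) (stdLat n) K := h1
    have g1 : ¬ IndexRel (p : ℕ) (fun i P => i = (p : ℕ) ^ 2 ∧ ¬ P)
      (fun i P => i = (p : ℕ) ^ 2 ∧ ¬ P) (stdLat n) K := fun h => h2 ⟨h.1.1, h.2.1⟩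
    have g2 : ¬ IndexRel (p : ℕ) (fun i P => i = (p : ℕ) ^ 2 ∧ P)
      (fun i P => i = (p : ℕ) ^ 2 ∧ ¬ P) (stdLat n) K := fun h => h2 ⟨h.1.1, h.2.1⟩
    have g3 : ¬ IndexRel (p : ℕ) (fun i P => i = (p : ℕ) ^ 2 ∧ ¬ P)
      (fun i P => i = (p : ℕ) ^ 2 ∧ P) (stdLat n) K := fun h => h2 ⟨h.1.1, h.2.1⟩
    have g4 : ¬ IndexRel (p : ℕ) (fun i P => i = (p : ℕ) ^ 2 ∧ P)
      (fun i P => i = (p : ℕ) ^ 2 ∧ P) (stdLat n) K := fun h => h2 ⟨h.1.1, h.2.1⟩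
    rw [h3, if_neg g0, if_neg g1, if_neg g2, if_neg g3, if_neg g4, if_neg h0]
    simp

end GLHecke

theorem corollaryB (n : ℕ) (hn : 4 ≤ n) (p q : ℕ+) (hp : p.Prime) (hq : q.Prime) :
    -- `diag(1, p, …, p)`, `diag(1, …, 1, q)` and `diag(1, p, …, p, pq)`
    (GLHecke.T n 1 0 1 p p ∘ₗ GLHecke.T n 0 1 1 1 q =
      GLHecke.T n 1 1 1 p (p * q) +
        (if p = q then (((p : ℕ) : ℂ) ^ n - 1) / (((p : ℕ) : ℂ) - 1) else 0) • LinearMap.id) ∧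
    -- `diag(1, p, …, p, p²)`, `diag(1, q, …, q, q²)` and `diag(1, pq, …, pq, (pq)²)`
    (GLHecke.T n 1 1 1 p (p ^ 2) ∘ₗ GLHecke.T n 1 1 1 q (q ^ 2) =
      GLHecke.T n 1 1 1 (p * q) ((p * q) ^ 2) +
        (if p = q then
          -- `diag(1, p, …, p, p²)`
          ((2 * ((p : ℕ) : ℂ) ^ n - ((p : ℕ) : ℂ) ^ 2 - 2 * ((p : ℕ) : ℂ) + 1) /
              (((p : ℕ) : ℂ) - 1)) • GLHecke.T n 1 1 1 p (p ^ 2) +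
          -- the identity
          (((p : ℕ) : ℂ) * ((((p : ℕ) : ℂ) ^ (n - 1) - 1) * (((p : ℕ) : ℂ) ^ n - 1)) /
              (((p : ℕ) : ℂ) - 1) ^ 2) • LinearMap.id +
          -- `diag(1, p², …, p², p³, p³)`
          (((p : ℕ) : ℂ) + 1) • GLHecke.T n 1 2 1 (p ^ 2) (p ^ 3) +
          -- `diag(1, 1, p, …, p, p³)`
          (((p : ℕ) : ℂ) + 1) • GLHecke.T n 2 1 1 p (p ^ 3) +
          -- `diag(1, 1, p, …, p, p², p²)`
          (((p : ℕ) : ℂ) + 1) ^ 2 • GLHecke.T n 2 2 1 p (p ^ 2)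
        else 0)) := by
  refine ⟨GLHecke.T_comp_over_under (by omega) hp hq, ?_⟩
  split_ifs with h
  · subst h
    exact GLHecke.T_comp_self hn hp
  · rw [add_zero]
    exact GLHecke.T_comp_of_ne (by omega) hp hq h
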